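/- Let $a\in(0,1)$ and let $p>0$ be a real number that is not an even integer. For an integer $n\ge 0$ let $$E_{n}(p,a)=\inf_{\deg P\le n}\ \sup_{x\in[-1,-a]\cup[a,1]}\bigl||x|^p-P(x)\bigr|$$ be the error of the best uniform approximation of $|x|^p$ on $[-1,-a]\cup[a,1]$ by real polynomials $P$ of degree at most $n$, and for an integer $m\ge 0$ let $P_m(\cdot,p,a)$ be the (existing and unique) polynomial of degree at most $2m$ for which the error $E_{2m}(p,a)$ is attained. Then $$\lim_{m\to\infty}\left(\frac{1+a}{1-a}\right)^{m+1}m^{\frac p2+1}E_{2m}(p,a)=a^{\frac p2-1}\,\frac{(1+a)^2}{2\left|\Gamma\left(-\frac p2\right)\right|}.$$ Moreover, uniformly for $\lambda$ in compact subsets of $(0,\infty)$, $$\lim_{m\to\infty}\left(\frac ma\right)^{\frac p2}P_m\left(\sqrt{\frac am}\,\lambda,\,p,\,a\right)=\lambda^p+\frac{\sin\frac{\pi p}2}{\pi}\int_0^\infty\mu^p e^{-(\lambda^2+\mu^2)}\,\frac{2\mu\,d\mu}{\lambda^2+\mu^2}.$$ -/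

import Mathlib

open Filter Topology Polynomial

noncomputable section

/-- The union `[-1, -a] ∪ [a, 1]`. -/
def twoIntervals (a : ℝ) : Set ℝ := Set.Icc (-1) (-a) ∪ Set.Icc a 1

/-- The uniform distance between `|x|^p` and the polynomial `P` on `[-1, -a] ∪ [a, 1]`. -/
def uniformDist (p a : ℝ) (P : ℝ[X]) : ℝ :=
  ⨆ x : twoIntervals a, |(|(x : ℝ)| ^ p) - P.eval (x : ℝ)|

/-- The error `E_n(p, a)` of the best uniform approximation of `|x|^p` on `[-1, -a] ∪ [a, 1]` by
real polynomials of degree at most `n`. -/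
def approxError (n : ℕ) (p a : ℝ) : ℝ :=
  ⨅ P : {P : ℝ[X] // P.natDegree ≤ n}, uniformDist p a P

/-- `P` is a best uniform approximation of `|x|^p` on `[-1, -a] ∪ [a, 1]` among the real
polynomials of degree at most `n`. -/
def IsBestApprox (n : ℕ) (p a : ℝ) (P : ℝ[X]) : Prop :=
  P.natDegree ≤ n ∧ ∀ Q : ℝ[X], Q.natDegree ≤ n → uniformDist p a P ≤ uniformDist p a Q

/-- The limit function of the renormalized extremal polynomials. -/
def limitFun (p l : ℝ) : ℝ :=
  l ^ p + Real.sin (Real.pi * p / 2) / Real.pi *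
    ∫ μ in Set.Ioi (0 : ℝ),
      μ ^ p * Real.exp (-(l ^ 2 + μ ^ 2)) * (2 * μ / (l ^ 2 + μ ^ 2))

end

/-! ### Best uniform approximation by polynomials on a compact set -/

/-! By uniqueness the best approximation is even, so t = x² turns the problem into approximating
t^s, s = p/2, on [a², 1] by polynomials of degree at most m. Put ρ = (1+a)/(1-a). The polynomial S =
`extremalPoly a m` is built so that S(t)/t oscillates between ±4/(1-a)² at m+2 points of [a², 1]
(`exists_alternation_extremalPoly`).

Let Q interpolate t^s at the zeros of S. Its error is -(sin πs/π) S(t) ∫ u^s / (S(-u)(t+u)) du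
(`exists_interpolation_polynomial`), that is, S(t)/t times an integral with the weight t/(t+u). This
weight lies between a²/(a²+u) and 1. The weight 1 bounds the error of Q from above; the weight
a²/(a²+u) and de la Vallée-Poussin's argument bound every error from below. Near the origin
S(aτ/m)/S(0) → e^{-τ}, so the integrals concentrate at u of order a/m, where both weights tend to 1.
Both bounds thus have the same asymptotics, with Γ(s+1)/S(0) turned into the stated constant by
Euler's reflection formula (`tendsto_error_constant`).

For the local limit, the error formula gives the limit of Q at scale a/m
(`tendsto_rescaled_interpolation`). The best polynomial differs from Q on [a², 1] by at most twice
the upper bound, and Chebyshev growth shows that this difference, rescaled near 0, is O(1/m)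
(`tendsto_rescaled_of_small`). -/

theorem exists_best_uniform_approx (K : Set ℝ) [CompactSpace K] (f : C(K, ℝ)) (n : ℕ) :
    ∃ P : ℝ[X], P.natDegree ≤ n ∧ ∀ Q : ℝ[X], Q.natDegree ≤ n →
      ‖f - P.toContinuousMapOn K‖ ≤ ‖f - Q.toContinuousMapOn K‖ := by
  set W : Submodule ℝ C(K, ℝ) :=
    (degreeLE ℝ n).map (toContinuousMapOnAlgHom K).toLinearMap with hW
  have : FiniteDimensional ℝ (degreeLE ℝ (n : WithBot ℕ)) := by
    rw [← degreeLT_succ_eq_degreeLE]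
    exact (degreeLTEquiv ℝ (n + 1)).symm.finiteDimensional
  have : FiniteDimensional ℝ W := by rw [hW]; infer_instance
  have : ProperSpace W := FiniteDimensional.proper ℝ W
  have hcont : Continuous fun w : W => ‖f - (w : C(K, ℝ))‖ := by fun_prop
  have hlim : Tendsto (fun w : W => ‖f - (w : C(K, ℝ))‖) (cocompact W) atTop := by
    refine tendsto_atTop_mono (f := fun w : W => ‖w‖ + -‖f‖) (fun w => ?_)
      (tendsto_atTop_add_const_right _ _ tendsto_norm_cocompact_atTop)
    have := norm_sub_norm_le (w : C(K, ℝ)) f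
    rw [norm_sub_rev] at this
    simpa [sub_eq_add_neg] using this
  obtain ⟨⟨w, hw⟩, hmin⟩ := hcont.exists_forall_le hlim
  obtain ⟨P, hP, rfl⟩ := hw
  refine ⟨P, natDegree_le_iff_degree_le.2 (mem_degreeLE.1 hP), fun Q hQ => ?_⟩
  exact hmin ⟨_, Q, mem_degreeLE.2 (natDegree_le_iff_degree_le.1 hQ), rfl⟩

/-- If the set where the error attains its norm has at most `n + 1` points, the polynomial can be
improved within degree `n`. -/
theorem exists_better_approx_of_card_le {K : Set ℝ} [CompactSpace K] {g : C(K, ℝ)} (hg : g ≠ 0)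
    {n : ℕ} (s : Finset K) (hs : s.card ≤ n + 1) (hext : ∀ x : K, |g x| = ‖g‖ → x ∈ s) :
    ∃ H : ℝ[X], H.natDegree ≤ n ∧ ‖g - H.toContinuousMapOn K‖ < ‖g‖ := by
  have hE : 0 < ‖g‖ := norm_pos_iff.2 hg
  have hle : ∀ x, |g x| ≤ ‖g‖ := fun x => g.norm_coe_le_norm x
  have hinj : Set.InjOn (fun x : K => (x : ℝ)) s := Subtype.val_injective.injOn
  -- H copies g at the extremal points, so subtracting a small multiple of H lowers |g| there.
  set H := Lagrange.interpolate s (fun x : K => (x : ℝ)) g with hH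
  have hHdeg : H.natDegree ≤ n := by
    have h1 := Lagrange.degree_interpolate_lt (s := s) (r := g) hinj
    rw [natDegree_le_iff_degree_le]
    by_cases h0 : H = 0
    · simp [h0]
    · rw [degree_eq_natDegree h0] at h1 ⊢
      have : H.natDegree < s.card := by exact_mod_cast h1
      exact_mod_cast (by omega : H.natDegree ≤ n)
  have hHev : ∀ x ∈ s, H.eval (x : ℝ) = g x := fun x hx =>
    Lagrange.eval_interpolate_at_node (v := fun x : K => (x : ℝ)) (r := g) hinj hx
  set h := H.toContinuousMapOn K with hh
  have hhx : ∀ x : K, h x = H.eval (x : ℝ) := fun x => rfl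
  have hlB : ∀ x, |h x| ≤ ‖h‖ := fun x => h.norm_coe_le_norm x
  -- On this neighbourhood of the extremal points g and h agree in sign; off it, compactness keeps
  -- |g| away from ‖g‖.
  set U : Set K := {x | ‖g‖ ^ 2 / 2 < g x * h x} with hU
  have hUo : IsOpen U := isOpen_lt continuous_const (by fun_prop)
  have hUc : IsCompact Uᶜ := hUo.isClosed_compl.isCompact
  have hlt : ∀ x ∈ Uᶜ, |g x| < ‖g‖ := by
    intro x hx
    refine lt_of_le_of_ne (hle x) fun heq => hx ?_
    have : g x * h x = ‖g‖ ^ 2 := by rw [hhx, hHev x (hext x heq), ← heq, sq_abs, sq]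
    rw [hU, Set.mem_ofPred_eq, this]
    nlinarith
  obtain ⟨E', hE', hE'lt⟩ : ∃ E', (∀ x ∈ Uᶜ, |g x| ≤ E') ∧ E' < ‖g‖ := by
    rcases Uᶜ.eq_empty_or_nonempty with he | hne
    · exact ⟨0, by simp [he], hE⟩
    · obtain ⟨x0, hx0, hmax⟩ := hUc.exists_isMaxOn hne
        (f := fun x => |g x|) (by fun_prop)
      exact ⟨|g x0|, fun x hx => hmax hx, hlt x0 hx0⟩
  set B := ‖h‖ with hB
  -- The first condition makes the gain 2εgh > ε‖g‖² on U exceed the loss ε²h²; the second keeps the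
  -- perturbation off U below the gap ‖g‖ - E'.
  obtain ⟨ε, hε0, hε1, hε2⟩ : ∃ ε > 0, ε * B ^ 2 < ‖g‖ ^ 2 ∧ ε * B < ‖g‖ - E' := by
    have h1 : ∀ᶠ ε in 𝓝[>] (0 : ℝ), ε * B ^ 2 < ‖g‖ ^ 2 :=
      ((Continuous.tendsto' (by fun_prop) 0 _ rfl : Tendsto (fun ε : ℝ => ε * B ^ 2) (𝓝 0)
        (𝓝 (0 * B ^ 2))).mono_left nhdsWithin_le_nhds).eventually_lt_const (by simp; positivity)
    have h2 : ∀ᶠ ε in 𝓝[>] (0 : ℝ), ε * B < ‖g‖ - E' :=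
      ((Continuous.tendsto' (by fun_prop) 0 _ rfl : Tendsto (fun ε : ℝ => ε * B) (𝓝 0)
        (𝓝 (0 * B))).mono_left nhdsWithin_le_nhds).eventually_lt_const (by simp; linarith)
    obtain ⟨ε, h1, h2, h3⟩ := (h1.and (h2.and self_mem_nhdsWithin)).exists
    exact ⟨ε, h3, h1, h2⟩
  refine ⟨C ε * H, (natDegree_C_mul_le _ _).trans hHdeg, ?_⟩
  rw [ContinuousMap.norm_lt_iff _ hE]
  intro x
  have hx : (g - (C ε * H).toContinuousMapOn K) x = g x - ε * h x := by simp [hhx]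
  rw [hx, Real.norm_eq_abs]
  by_cases hxU : x ∈ U
  · apply abs_lt_of_sq_lt_sq _ hE.le
    have h1 : ‖g‖ ^ 2 / 2 < g x * h x := hxU
    have h2 : g x ^ 2 ≤ ‖g‖ ^ 2 := by rw [← sq_abs]; gcongr; exact hle x
    have h3 : h x ^ 2 ≤ B ^ 2 := by rw [← sq_abs]; gcongr; exact hlB x
    have h4 : ε * (ε * h x ^ 2) ≤ ε * (ε * B ^ 2) := by gcongr
    have h5 : ε * (ε * B ^ 2) < ε * ‖g‖ ^ 2 := by gcongr
    have h6 : ε * (‖g‖ ^ 2 / 2) < ε * (g x * h x) := by gcongr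
    nlinarith
  · have h1 : |ε * h x| ≤ ε * B := by rw [abs_mul, abs_of_pos hε0]; gcongr; exact hlB x
    have := abs_sub (g x) (ε * h x)
    have := hE' x hxU
    linarith

/-- The midpoint of two best approximations is again best. Where its error is extremal, both errors
are extremal with the same sign, so P = Q there. There must be at least n + 1 such points, since
otherwise the midpoint could be improved. -/
theorem best_uniform_approx_unique {K : Set ℝ} [CompactSpace K] (hK : K.Infinite) (f : C(K, ℝ))
    {n : ℕ} {P Q : ℝ[X]} (hP : P.natDegree ≤ n) (hQ : Q.natDegree ≤ n)
    (hPb : ∀ R : ℝ[X], R.natDegree ≤ n →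
      ‖f - P.toContinuousMapOn K‖ ≤ ‖f - R.toContinuousMapOn K‖)
    (hQb : ∀ R : ℝ[X], R.natDegree ≤ n →
      ‖f - Q.toContinuousMapOn K‖ ≤ ‖f - R.toContinuousMapOn K‖) : P = Q := by
  have : Infinite K := hK.to_subtype
  have hEq : ‖f - Q.toContinuousMapOn K‖ = ‖f - P.toContinuousMapOn K‖ :=
    le_antisymm (hQb P hP) (hPb Q hQ)
  set R : ℝ[X] := C (1 / 2) * (P + Q) with hR
  have hRdeg : R.natDegree ≤ n :=
    (natDegree_C_mul_le _ _).trans (natDegree_add_le_of_degree_le hP hQ)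
  set g := f - R.toContinuousMapOn K with hg
  have hgx : ∀ x : K, g x = ((f x - P.eval (x : ℝ)) + (f x - Q.eval (x : ℝ))) / 2 := by
    intro x; simp [hg, hR]; ring
  have hPx : ∀ x : K, |f x - P.eval (x : ℝ)| ≤ ‖f - P.toContinuousMapOn K‖ := fun x => by
    simpa using (f - P.toContinuousMapOn K).norm_coe_le_norm x
  have hQx : ∀ x : K, |f x - Q.eval (x : ℝ)| ≤ ‖f - P.toContinuousMapOn K‖ := fun x => by
    rw [← hEq]; simpa using (f - Q.toContinuousMapOn K).norm_coe_le_norm x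
  have hgn : ‖g‖ = ‖f - P.toContinuousMapOn K‖ := by
    refine le_antisymm ?_ (hPb R hRdeg)
    rw [ContinuousMap.norm_le _ (norm_nonneg _)]
    intro x
    rw [hgx, Real.norm_eq_abs, abs_le]
    have h1 := abs_le.1 (hPx x)
    have h2 := abs_le.1 (hQx x)
    constructor <;> linarith
  have hext : ∀ x : K, |g x| = ‖g‖ → P.eval (x : ℝ) = Q.eval (x : ℝ) := by
    intro x hx
    rw [hgn, hgx] at hx
    have h1 := abs_le.1 (hPx x)
    have h2 := abs_le.1 (hQx x)
    rcases abs_choice (((f x - P.eval (x : ℝ)) + (f x - Q.eval (x : ℝ))) / 2) with h | h <;>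
      rw [h] at hx <;> linarith
  obtain ⟨t, htc, ht⟩ : ∃ t : Finset K, n + 1 ≤ t.card ∧ ∀ x ∈ t, |g x| = ‖g‖ := by
    by_contra! hcon
    have hfin : {x : K | |g x| = ‖g‖}.Finite := by
      by_contra hinf
      obtain ⟨t, ht, htc⟩ := Set.Infinite.exists_subset_card_eq hinf (n + 1)
      obtain ⟨x, hx, hne⟩ := hcon t htc.ge
      exact hne (ht hx)
    have hcard : hfin.toFinset.card ≤ n + 1 := by
      by_contra! hlt
      obtain ⟨x, hx, hne⟩ := hcon hfin.toFinset hlt.le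
      exact hne (hfin.mem_toFinset.1 hx)
    -- A zero error would make every point of the infinite set K extremal.
    have hg0 : g ≠ 0 := by
      intro h0
      have : {x : K | |g x| = ‖g‖} = Set.univ := by ext x; simp [h0]
      rw [this] at hfin
      exact Set.infinite_univ hfin
    obtain ⟨H, hH, hlt⟩ := exists_better_approx_of_card_le hg0 hfin.toFinset hcard
      (fun x hx => hfin.mem_toFinset.2 hx)
    have h1 := hPb (R + H) (natDegree_add_le_of_degree_le hRdeg hH)
    have h2 : f - (R + H).toContinuousMapOn K = g - H.toContinuousMapOn K := by
      ext x; simp [hg]; ring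
    rw [h2, ← hgn] at h1
    linarith
  refine eq_of_degree_sub_lt_of_eval_finset_eq (t.map ⟨Subtype.val, Subtype.val_injective⟩) ?_ ?_
  · rw [Finset.card_map]
    refine lt_of_le_of_lt (b := (n : WithBot ℕ)) ?_ (by exact_mod_cast htc)
    exact natDegree_le_iff_degree_le.1 ((natDegree_sub_le_of_le hP hQ).trans (max_self n).le)
  · intro x hx
    obtain ⟨y, hy, rfl⟩ := Finset.mem_map.1 hx
    exact hext y (ht y hy)

/-! ### Best approximation on the two intervals, and its evenness -/

instance compactSpace_twoIntervals (a : ℝ) : CompactSpace (twoIntervals a) :=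
  isCompact_iff_compactSpace.1 (isCompact_Icc.union isCompact_Icc)

theorem uniformDist_eq_norm {p : ℝ} (hp : 0 ≤ p) (a : ℝ) (P : ℝ[X]) :
    uniformDist p a P = ‖(⟨fun x : twoIntervals a => |(x : ℝ)| ^ p,
      (Real.continuous_rpow_const hp).comp (by fun_prop)⟩ : C(twoIntervals a, ℝ))
        - P.toContinuousMapOn (twoIntervals a)‖ := by
  rw [ContinuousMap.norm_eq_iSup_norm]
  rfl

theorem existsUnique_isBestApprox {p a : ℝ} (hp : 0 ≤ p) (ha : a < 1) (n : ℕ) :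
    ∃! P : ℝ[X], IsBestApprox n p a P := by
  have hinf : (twoIntervals a).Infinite := (Set.Icc_infinite ha).mono Set.subset_union_right
  obtain ⟨P, hP, hPb⟩ := exists_best_uniform_approx (twoIntervals a)
    (⟨fun x : twoIntervals a => |(x : ℝ)| ^ p,
      (Real.continuous_rpow_const hp).comp (by fun_prop)⟩ : C(twoIntervals a, ℝ)) n
  refine ⟨P, ⟨hP, fun Q hQ => ?_⟩, fun Q hQ => ?_⟩
  · simpa only [uniformDist_eq_norm hp] using hPb Q hQ
  · have h2 := hQ.2
    simp only [uniformDist_eq_norm hp] at h2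
    exact best_uniform_approx_unique hinf _ hQ.1 hP h2 hPb

theorem abs_sub_eval_le_uniformDist {p a : ℝ} (hp : 0 ≤ p) (P : ℝ[X]) {x : ℝ}
    (hx : x ∈ twoIntervals a) : |(|x| ^ p) - P.eval x| ≤ uniformDist p a P := by
  rw [uniformDist_eq_norm hp]
  exact ContinuousMap.norm_coe_le_norm ((⟨fun x : twoIntervals a => |(x : ℝ)| ^ p,
      (Real.continuous_rpow_const hp).comp (by fun_prop)⟩ : C(twoIntervals a, ℝ))
        - P.toContinuousMapOn (twoIntervals a)) (⟨x, hx⟩ : twoIntervals a)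

theorem uniformDist_le {p a M : ℝ} (ha : a ≤ 1) {P : ℝ[X]}
    (h : ∀ x ∈ twoIntervals a, |(|x| ^ p) - P.eval x| ≤ M) : uniformDist p a P ≤ M := by
  have : Nonempty (twoIntervals a) := ⟨⟨1, Or.inr ⟨ha, le_rfl⟩⟩⟩
  exact ciSup_le fun x => h x x.2

theorem approxError_eq_of_isBestApprox {n : ℕ} {p a : ℝ} {P : ℝ[X]} (h : IsBestApprox n p a P) :
    approxError n p a = uniformDist p a P := by
  have : Nonempty {P : ℝ[X] // P.natDegree ≤ n} := ⟨⟨P, h.1⟩⟩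
  refine le_antisymm (ciInf_le ⟨uniformDist p a P, ?_⟩ (⟨P, h.1⟩ : {P : ℝ[X] // P.natDegree ≤ n}))
    (le_ciInf fun Q => h.2 Q Q.2)
  rintro _ ⟨Q, rfl⟩
  exact h.2 Q Q.2

/-- The best approximation is even, hence a polynomial in `x ^ 2`. -/
theorem IsBestApprox.exists_expand {m : ℕ} {p a : ℝ} (hp : 0 ≤ p) (ha : a < 1) {P : ℝ[X]}
    (h : IsBestApprox (2 * m) p a P) :
    ∃ q : ℝ[X], q.natDegree ≤ m ∧ P = expand ℝ 2 q := by
  have hdeg : (P.comp (-X)).natDegree ≤ 2 * m := by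
    simpa [natDegree_comp] using h.1
  have hb : IsBestApprox (2 * m) p a (P.comp (-X)) := by
    refine ⟨hdeg, fun Q hQ => le_trans (uniformDist_le ha.le fun x hx => ?_) (h.2 Q hQ)⟩
    have hx' : -x ∈ twoIntervals a := by
      rcases hx with hx | hx
      · exact Or.inr ⟨by linarith [hx.2], by linarith [hx.1]⟩
      · exact Or.inl ⟨by linarith [hx.2], by linarith [hx.1]⟩
    simpa using abs_sub_eval_le_uniformDist hp P hx'
  -- The reflected polynomial is also best, so uniqueness forces evenness.
  have heq : P.comp (-X) = P := (existsUnique_isBestApprox hp ha (2 * m)).unique hb h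
  have hPq : P = expand ℝ 2 (contract 2 P) := by
    ext i
    rw [coeff_expand two_pos]
    split_ifs with hi
    · rw [coeff_contract two_ne_zero, Nat.div_mul_cancel hi]
    · have h1 := congrArg (fun R => R.coeff i) heq
      have hodd : Odd i := by rwa [← Nat.not_even_iff_odd, even_iff_two_dvd]
      have hX : (-X : ℝ[X]) = C (-1) * X := by simp
      simp only [hX, comp_C_mul_X_coeff, hodd.neg_one_pow] at h1
      linarith
  refine ⟨contract 2 P, ?_, hPq⟩
  have h2 := h.1
  rw [hPq, natDegree_expand] at h2
  omega

/-! ### Alternation -/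

/-- Strict alternation at m + 2 points would produce m + 1 distinct roots, one in each gap, hence D
= 0. -/
theorem Polynomial.exists_index_of_alternating {D : ℝ[X]} {m : ℕ} (hD : D.natDegree ≤ m)
    (x : ℕ → ℝ) (hx : ∀ j ≤ m, x j < x (j + 1)) :
    ∃ j ≤ m + 1, (-1) ^ j * D.eval (x j) ≤ 0 := by
  by_contra! hpos
  have hroot : ∀ j : Fin (m + 1), ∃ r, x j < r ∧ r < x (j + 1) ∧ D.eval r = 0 := by
    intro j
    have hj : (j : ℕ) ≤ m := Nat.lt_succ_iff.1 j.2
    have h1 := hpos j (by omega)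
    have h2 := hpos (j + 1) (by omega)
    rw [pow_succ] at h2
    have hcont : ContinuousOn (fun t => (-1) ^ (j : ℕ) * D.eval t) (Set.Icc (x j) (x (j + 1))) := by
      fun_prop
    obtain ⟨r, hr, hr0⟩ := intermediate_value_Ioo' (hx j hj).le hcont
      (show (0 : ℝ) ∈ Set.Ioo _ _ from ⟨by linarith, h1⟩)
    exact ⟨r, hr.1, hr.2, by simpa using hr0⟩
  choose r hr1 hr2 hr0 using hroot
  have hmono : ∀ i j : ℕ, i ≤ j → j ≤ m + 1 → x i ≤ x j := by
    intro i j hij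
    induction j, hij using Nat.le_induction with
    | base => intro _; exact le_rfl
    | succ k hk ih => intro hk'; exact (ih (by omega)).trans (hx k (by omega)).le
  have hinj : StrictMono r := by
    intro i j hij
    have := hmono (i + 1) j hij (by omega)
    linarith [hr2 i, hr1 j]
  have h0 := eq_zero_of_natDegree_lt_card_of_eval_eq_zero D hinj.injective hr0
    (by simpa using Nat.lt_succ_of_le hD)
  have := hpos 0 (by omega)
  simp [h0] at this

/-- The lower bound of de la Vallée-Poussin: an error that alternates with size at least `L` at
`m + 2` points bounds every other error from below. -/
theorem exists_le_abs_sub_of_alternating {Q q : ℝ[X]} {m : ℕ} (hQ : Q.natDegree ≤ m)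
    (hq : q.natDegree ≤ m) (x : ℕ → ℝ) (hx : ∀ j ≤ m, x j < x (j + 1)) (f : ℝ → ℝ) {ε L : ℝ}
    (hε : |ε| ≤ 1) (h : ∀ j ≤ m + 1, L ≤ (-1) ^ j * (ε * (f (x j) - Q.eval (x j)))) :
    ∃ j ≤ m + 1, L ≤ |f (x j) - q.eval (x j)| := by
  -- At this index q - Q does not help: f - q = (f - Q) - (q - Q) keeps at least the size L.
  obtain ⟨j, hj, hle⟩ := exists_index_of_alternating (D := C ε * (q - Q)) (m := m)
    ((natDegree_C_mul_le _ _).trans ((natDegree_sub_le_of_le hq hQ).trans (max_self m).le)) x hx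
  refine ⟨j, hj, ?_⟩
  have h1 := h j hj
  simp only [eval_mul, eval_C, eval_sub] at hle
  have h2 : (-1) ^ j * (ε * (f (x j) - q.eval (x j))) ≤ |f (x j) - q.eval (x j)| := by
    refine (le_abs_self _).trans ?_
    rw [abs_mul, abs_mul, abs_pow, abs_neg, abs_one, one_pow, one_mul]
    exact mul_le_of_le_one_left (abs_nonneg _) hε
  nlinarith

/-- The points are chosen from the right, each by the intermediate value theorem to the left of its
successor; Φ need not be monotone. -/
theorem exists_increasing_preimages {Φ : ℝ → ℝ} (hΦ : Continuous Φ) {c : ℝ} (hc : 0 < c)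
    (h0 : Φ 0 = 0) (N : ℕ) {b : ℝ} (hb : 0 ≤ b) (hbN : Φ b = N * c) :
    ∃ θ : ℕ → ℝ, (∀ j ≤ N, θ j ∈ Set.Icc 0 b ∧ Φ (θ j) = j * c) ∧ ∀ j < N, θ j < θ (j + 1) := by
  induction N generalizing b with
  | zero => exact ⟨fun _ => b, fun j hj => by simp_all, by simp⟩
  | succ N ih =>
    push_cast at hbN
    obtain ⟨b', hb', hbN'⟩ := intermediate_value_Icc hb hΦ.continuousOn
      (show (N * c : ℝ) ∈ Set.Icc (Φ 0) (Φ b) by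
        rw [h0, hbN]; constructor <;> nlinarith [(Nat.cast_nonneg N : (0 : ℝ) ≤ N)])
    have hlt : b' < b := lt_of_le_of_ne hb'.2 (by rintro rfl; nlinarith)
    obtain ⟨θ, hθ, hθm⟩ := ih hb'.1 hbN'
    refine ⟨Function.update θ (N + 1) b, fun j hj => ?_, fun j hj => ?_⟩
    · rcases eq_or_lt_of_le hj with rfl | hj'
      · simp [hb, hbN]
      · have := hθ j (by omega)
        rw [Function.update_of_ne (by omega)]
        exact ⟨⟨this.1.1, this.1.2.trans hlt.le⟩, this.2⟩
    · rw [Function.update_of_ne (by omega)]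
      rcases eq_or_lt_of_le (Nat.lt_succ_iff.1 hj) with rfl | hj'
      · simpa using ((hθ j le_rfl).1.2).trans_lt hlt
      · rw [Function.update_of_ne (by omega)]
        exact hθm j hj'

/-! ### The extremal polynomial -/

/-- The affine map that takes `[a ^ 2, 1]` to `[-1, 1]`, reversing the orientation. -/
noncomputable def toUnit (a t : ℝ) : ℝ := (1 + a ^ 2 - 2 * t) / (1 - a ^ 2)

theorem toUnit_mem_Icc {a t : ℝ} (ha0 : 0 < a) (ha1 : a < 1) (h1 : a ^ 2 ≤ t) (h2 : t ≤ 1) :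
    toUnit a t ∈ Set.Icc (-1) 1 := by
  have h : 0 < 1 - a ^ 2 := by nlinarith
  unfold toUnit
  constructor
  · rw [le_div_iff₀ h]; linarith
  · rw [div_le_iff₀ h]; linarith

theorem one_lt_toUnit {a t : ℝ} (ha0 : 0 < a) (ha1 : a < 1) (h1 : t < a ^ 2) :
    1 < toUnit a t := by
  have h : 0 < 1 - a ^ 2 := by nlinarith
  unfold toUnit
  rw [lt_div_iff₀ h]; linarith

/-- Growth of polynomials outside `[a ^ 2, 1]`. -/
theorem abs_eval_le_mul_chebyshev {a t M : ℝ} (ha0 : 0 < a) (ha1 : a < 1) (ht : t < a ^ 2)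
    (hM : 0 < M) {m : ℕ} {q : ℝ[X]} (hq : q.natDegree ≤ m)
    (hb : ∀ t ∈ Set.Icc (a ^ 2) 1, |q.eval t| ≤ M) :
    |q.eval t| ≤ M * (Chebyshev.T ℝ m).eval (toUnit a t) := by
  have h : 0 < 1 - a ^ 2 := by nlinarith
  set A : ℝ[X] := C ((1 + a ^ 2) / 2) - C ((1 - a ^ 2) / 2) * X with hA
  have hAdeg : A.natDegree ≤ 1 := by rw [hA]; compute_degree
  have hAt : A.eval (toUnit a t) = t := by
    simp only [hA, toUnit, eval_sub, eval_C, eval_mul, eval_X]; field_simp; ring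
  have key : ∀ κ : ℝ, |κ| = M⁻¹ → κ * q.eval t ≤ (Chebyshev.T ℝ m).eval (toUnit a t) := by
    intro κ hκ
    have := Chebyshev.eval_iterate_derivative_le_of_forall_abs_le_one (n := m) (k := 0)
      (P := C κ * q.comp A) (one_lt_toUnit ha0 ha1 ht).le
      (natDegree_le_iff_degree_le.1 ((natDegree_C_mul_le _ _).trans (natDegree_comp_le.trans (by
        calc _ ≤ m * 1 := Nat.mul_le_mul hq hAdeg
          _ = m := mul_one m)))) ?_
    · simpa [eval_comp, hAt] using this
    · intro x hx
      rw [eval_mul, eval_C, eval_comp, abs_mul, hκ, inv_mul_le_iff₀ hM, mul_one]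
      apply hb
      simp only [hA, eval_sub, eval_C, eval_mul, eval_X]
      constructor <;> nlinarith [hx.1, hx.2]
  rw [abs_le]
  have h1 := key M⁻¹ (abs_of_pos (by positivity))
  have h2 := key (-M⁻¹) (by rw [abs_neg, abs_of_pos (by positivity)])
  rw [inv_mul_le_iff₀ hM] at h1
  rw [neg_mul, ← mul_neg, inv_mul_le_iff₀ hM] at h2
  constructor <;> linarith

/-- The polynomial of degree `m + 1` whose quotient by `t` equioscillates on `[a ^ 2, 1]`. -/
noncomputable def extremalPoly (a : ℝ) (m : ℕ) : ℝ[X] :=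
  (C (((1 + a) / (1 - a)) ^ 2) * Chebyshev.T ℝ (m + 1)
    - C (2 * ((1 + a) / (1 - a))) * Chebyshev.T ℝ m + Chebyshev.T ℝ (m - 1)).comp
  (C ((1 + a ^ 2) / (1 - a ^ 2)) - C (2 / (1 - a ^ 2)) * X)

theorem natDegree_extremalPoly_le (a : ℝ) (m : ℕ) : (extremalPoly a m).natDegree ≤ m + 1 := by
  refine natDegree_comp_le.trans ?_
  have h1 : (C ((1 + a ^ 2) / (1 - a ^ 2)) - C (2 / (1 - a ^ 2)) * X : ℝ[X]).natDegree ≤ 1 := by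
    compute_degree
  refine (Nat.mul_le_mul (n₂ := m + 1) ?_ h1).trans (mul_one _).le
  refine natDegree_add_le_of_degree_le (natDegree_sub_le_of_le (p := C _ * _) (m := m + 1)
    (n := m + 1) ?_ ?_ |>.trans (max_self _).le) ?_
  · exact (natDegree_C_mul_le _ _).trans (by rw [Chebyshev.natDegree_T]; omega)
  · exact (natDegree_C_mul_le _ _).trans (by rw [Chebyshev.natDegree_T]; omega)
  -- The index is an integer: for m = 0 the polynomial T₋₁ = T₁ still has degree m + 1.
  · rw [Chebyshev.natDegree_T]; omega

theorem eval_extremalPoly (a : ℝ) (m : ℕ) (t : ℝ) : (extremalPoly a m).eval t =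
    ((1 + a) / (1 - a)) ^ 2 * (Chebyshev.T ℝ (m + 1)).eval (toUnit a t)
    - 2 * ((1 + a) / (1 - a)) * (Chebyshev.T ℝ m).eval (toUnit a t)
    + (Chebyshev.T ℝ (m - 1)).eval (toUnit a t) := by
  have : (1 + a ^ 2) / (1 - a ^ 2) - 2 / (1 - a ^ 2) * t = toUnit a t := by
    unfold toUnit; ring
  simp [extremalPoly, this]

/-- The phase of the extremal polynomial. -/
noncomputable def extremalPhase (a : ℝ) (m : ℕ) (θ : ℝ) : ℝ :=
  (m + 1) * θ + 2 * Real.arctan (Real.sin θ / ((1 + a) / (1 - a) - Real.cos θ))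

theorem cos_lt_ratio {a : ℝ} (ha0 : 0 < a) (ha1 : a < 1) (θ : ℝ) :
    Real.cos θ < (1 + a) / (1 - a) := by
  refine (Real.cos_le_one θ).trans_lt ?_
  rw [lt_div_iff₀ (by linarith)]; linarith

theorem continuous_extremalPhase {a : ℝ} (ha0 : 0 < a) (ha1 : a < 1) (m : ℕ) :
    Continuous (extremalPhase a m) := by
  unfold extremalPhase
  have : ∀ θ, (1 + a) / (1 - a) - Real.cos θ ≠ 0 := fun θ => by
    linarith [cos_lt_ratio ha0 ha1 θ] |> fun h : 0 < (1 + a) / (1 - a) - Real.cos θ => h.ne'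
  have := Real.continuous_arctan
  fun_prop (disch := assumption)

/-- Both sides are the real part of e^{iψ}(ρ - e^{-iθ})²: the squared modulus of ρ - e^{-iθ} is ρ² +
1 - 2ρ cos θ, and its argument is the arctangent. -/
theorem cos_two_arctan_mul_add (ρ ψ θ : ℝ) (h : Real.cos θ < ρ) :
    (ρ ^ 2 + 1 - 2 * ρ * Real.cos θ)
      * Real.cos (ψ + 2 * Real.arctan (Real.sin θ / (ρ - Real.cos θ))) =
    ρ ^ 2 * Real.cos ψ - 2 * ρ * Real.cos (ψ - θ) + Real.cos (ψ - 2 * θ) := by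
  set y := Real.sin θ / (ρ - Real.cos θ) with hy
  have hd : ρ - Real.cos θ ≠ 0 := by linarith
  have hsc := Real.sin_sq_add_cos_sq θ
  have h1 : (ρ ^ 2 + 1 - 2 * ρ * Real.cos θ) = (1 + y ^ 2) * (ρ - Real.cos θ) ^ 2 := by
    rw [hy]; field_simp; linear_combination -hsc
  have hcos : (1 + y ^ 2) * Real.cos (2 * Real.arctan y) = 1 - y ^ 2 := by
    rw [Real.cos_two_mul, Real.cos_sq_arctan]; field_simp; ring
  have hsin : (1 + y ^ 2) * Real.sin (2 * Real.arctan y) = 2 * y := by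
    have h2 : Real.sin (Real.arctan y) * Real.cos (Real.arctan y) = y / (1 + y ^ 2) := by
      rw [← Real.tan_mul_cos (Real.cos_arctan_pos y).ne', mul_assoc, ← sq, Real.cos_sq_arctan,
        Real.tan_arctan]; ring
    rw [Real.sin_two_mul, mul_assoc, h2]
    have : (1 + y ^ 2) ≠ 0 := by positivity
    field_simp
  have hyd : y * (ρ - Real.cos θ) = Real.sin θ := by rw [hy]; field_simp
  have e1 : (ρ ^ 2 + 1 - 2 * ρ * Real.cos θ) * Real.cos (2 * Real.arctan y)
      = (ρ - Real.cos θ) ^ 2 - Real.sin θ ^ 2 := by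
    rw [h1, ← hyd]; linear_combination (ρ - Real.cos θ) ^ 2 * hcos
  have e2 : (ρ ^ 2 + 1 - 2 * ρ * Real.cos θ) * Real.sin (2 * Real.arctan y)
      = 2 * Real.sin θ * (ρ - Real.cos θ) := by
    rw [h1]; linear_combination (ρ - Real.cos θ) ^ 2 * hsin + 2 * (ρ - Real.cos θ) * hyd
  rw [Real.cos_add, Real.cos_sub, Real.cos_sub, Real.cos_two_mul θ, Real.sin_two_mul θ]
  linear_combination Real.cos ψ * e1 - Real.sin ψ * e2 - Real.cos ψ * hsc

/-- This is why ρ = (1+a)/(1-a): since ρ + 1/ρ = 2 `toUnit a 0`, the factor ρ² + 1 - 2ρ cos θ is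
proportional to t. -/
theorem eval_extremalPoly_eq_cos {a t θ : ℝ} (ha0 : 0 < a) (ha1 : a < 1) (m : ℕ)
    (h : toUnit a t = Real.cos θ) :
    (extremalPoly a m).eval t = 4 / (1 - a) ^ 2 * t * Real.cos (extremalPhase a m θ) := by
  have h1 : 1 - a ≠ 0 := by linarith
  have h2 : 1 - a ^ 2 ≠ 0 := by nlinarith
  have h3 : 1 + a ≠ 0 := by linarith
  have hk : 4 / (1 - a) ^ 2 * t
      = ((1 + a) / (1 - a)) ^ 2 + 1 - 2 * ((1 + a) / (1 - a)) * Real.cos θ := by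
    rw [← h, toUnit, show 1 - a ^ 2 = (1 - a) * (1 + a) by ring]; field_simp; ring
  rw [hk, extremalPhase, cos_two_arctan_mul_add _ _ _ (cos_lt_ratio ha0 ha1 θ), eval_extremalPoly,
    h, Chebyshev.T_real_cos, Chebyshev.T_real_cos, Chebyshev.T_real_cos]
  push_cast
  ring_nf

theorem abs_eval_extremalPoly_le {a t : ℝ} (ha0 : 0 < a) (ha1 : a < 1) (m : ℕ)
    (h1 : a ^ 2 ≤ t) (h2 : t ≤ 1) : |(extremalPoly a m).eval t| ≤ 4 / (1 - a) ^ 2 * t := by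
  have hu := toUnit_mem_Icc ha0 ha1 h1 h2
  rw [eval_extremalPoly_eq_cos ha0 ha1 m (Real.cos_arccos hu.1 hu.2).symm, abs_mul]
  have ht : 0 ≤ 4 / (1 - a) ^ 2 * t := by have := sq_nonneg a; positivity [h1.trans' this]
  rw [abs_of_nonneg ht]
  exact mul_le_of_le_one_right ht (Real.abs_cos_le_one _)

/-- The sine vanishes at 0 and π, so the phase runs from 0 to (m+1)π and meets m + 2 multiples of π.
-/
theorem exists_alternation_extremalPoly {a : ℝ} (ha0 : 0 < a) (ha1 : a < 1) (m : ℕ) :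
    ∃ t : ℕ → ℝ, (∀ j ≤ m, t j < t (j + 1)) ∧ ∀ j ≤ m + 1, t j ∈ Set.Icc (a ^ 2) 1 ∧
      (extremalPoly a m).eval (t j) = (-1) ^ j * (4 / (1 - a) ^ 2 * t j) := by
  have h2 : 0 < 1 - a ^ 2 := by nlinarith
  obtain ⟨θ, hθ, hmono⟩ := exists_increasing_preimages (continuous_extremalPhase ha0 ha1 m)
    Real.pi_pos (by simp [extremalPhase]) (m + 1) Real.pi_pos.le
    (by simp [extremalPhase])
  refine ⟨fun j => (1 + a ^ 2) / 2 - (1 - a ^ 2) / 2 * Real.cos (θ j), fun j hj => ?_,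
    fun j hj => ⟨?_, ?_⟩⟩
  · have := Real.strictAntiOn_cos (hθ j (by omega)).1 (hθ (j + 1) (by omega)).1
      (hmono j (by omega))
    dsimp only
    nlinarith
  · constructor <;> nlinarith [Real.cos_le_one (θ j), Real.neg_one_le_cos (θ j)]
  · rw [eval_extremalPoly_eq_cos ha0 ha1 m (θ := θ j), (hθ j hj).2, Real.cos_nat_mul_pi]
    · ring
    · unfold toUnit; field_simp; ring

/-! ### The extremal polynomial to the left of `[a ^ 2, 1]` -/

/-- Green's function of the complement of `[a ^ 2, 1]`, to the left of that interval. -/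
noncomputable def greenFun (a t : ℝ) : ℝ := Real.arcosh (toUnit a t)

/-- The hyperbolic counterpart of the cosine formula. The first exponential dominates for large m;
the second vanishes at t = 0, where e^{g} = ρ for g = `greenFun a 0`. -/
theorem eval_extremalPoly_eq_exp {a t : ℝ} (ha0 : 0 < a) (ha1 : a < 1) (m : ℕ) (ht : t < a ^ 2) :
    (extremalPoly a m).eval t =
      (Real.exp ((m + 1) * greenFun a t) * ((1 + a) / (1 - a) - Real.exp (-greenFun a t)) ^ 2
      + Real.exp (-((m + 1) * greenFun a t)) * ((1 + a) / (1 - a) - Real.exp (greenFun a t)) ^ 2)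
        / 2 := by
  have h : toUnit a t = Real.cosh (greenFun a t) :=
    (Real.cosh_arcosh (one_lt_toUnit ha0 ha1 ht).le).symm
  set y := greenFun a t
  rw [eval_extremalPoly, h, Chebyshev.T_real_cosh, Chebyshev.T_real_cosh, Chebyshev.T_real_cosh]
  push_cast
  have e1 : (m : ℝ) * y = (m + 1) * y + -y := by ring
  have e2 : ((m : ℝ) - 1) * y = (m + 1) * y + -y + -y := by ring
  rw [e2, e1]
  simp only [Real.cosh_eq, neg_add, neg_neg, Real.exp_add]
  ring

theorem exp_greenFun_zero {a : ℝ} (ha0 : 0 < a) (ha1 : a < 1) :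
    Real.exp (greenFun a 0) = (1 + a) / (1 - a) := by
  have h1 : 1 - a ≠ 0 := by linarith
  have h2 : 0 < 1 - a ^ 2 := by nlinarith
  rw [greenFun, Real.exp_arcosh (one_lt_toUnit ha0 ha1 (by positivity)).le]
  have : toUnit a 0 ^ 2 - 1 = (2 * a / (1 - a ^ 2)) ^ 2 := by
    unfold toUnit; field_simp; ring
  rw [this, Real.sqrt_sq (by positivity), toUnit, ← add_div,
    div_eq_div_iff h2.ne' h1]
  ring

theorem exp_neg_greenFun_zero {a : ℝ} (ha0 : 0 < a) (ha1 : a < 1) :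
    Real.exp (-greenFun a 0) = (1 - a) / (1 + a) := by
  rw [Real.exp_neg, exp_greenFun_zero ha0 ha1, inv_div]

theorem eval_zero_extremalPoly {a : ℝ} (ha0 : 0 < a) (ha1 : a < 1) (m : ℕ) :
    (extremalPoly a m).eval 0 = ((1 + a) / (1 - a)) ^ (m + 1) *
      ((1 + a) / (1 - a) - (1 - a) / (1 + a)) ^ 2 / 2 := by
  rw [eval_extremalPoly_eq_exp ha0 ha1 m (by positivity), exp_neg_greenFun_zero ha0 ha1,
    exp_greenFun_zero ha0 ha1, ← exp_greenFun_zero ha0 ha1, ← Real.exp_nat_mul]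
  simp

theorem ratio_sub_inv_pos {a : ℝ} (ha0 : 0 < a) (ha1 : a < 1) :
    0 < (1 + a) / (1 - a) - (1 - a) / (1 + a) := by
  rw [sub_pos, div_lt_div_iff₀ (by linarith) (by linarith)]; nlinarith

theorem eval_zero_extremalPoly_pos {a : ℝ} (ha0 : 0 < a) (ha1 : a < 1) (m : ℕ) :
    0 < (extremalPoly a m).eval 0 := by
  rw [eval_zero_extremalPoly ha0 ha1]
  have h := ratio_sub_inv_pos ha0 ha1
  have h1 : 0 < 1 - a := by linarith
  positivity

/-- In e^{arcosh x} = x + √(x² - 1), the first summand alone supplies the linear growth in u. -/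
theorem exp_greenFun_neg_ge {a u : ℝ} (ha0 : 0 < a) (ha1 : a < 1) (hu : 0 ≤ u) :
    (1 + a) / (1 - a) * (1 + 2 / (1 + a) ^ 2 * u) ≤ Real.exp (greenFun a (-u)) := by
  have h1 : 0 < 1 - a := by linarith
  have h2 : 0 < 1 - a ^ 2 := by nlinarith
  have hx0 : 1 < toUnit a 0 := one_lt_toUnit ha0 ha1 (by positivity)
  have hx : toUnit a (-u) = toUnit a 0 + 2 / (1 - a ^ 2) * u := by unfold toUnit; ring
  have hle : toUnit a 0 ≤ toUnit a (-u) := by rw [hx]; simp; positivity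
  have h0 := exp_greenFun_zero ha0 ha1
  rw [greenFun, Real.exp_arcosh hx0.le] at h0
  rw [greenFun, Real.exp_arcosh (hx0.le.trans hle)]
  have hs : √(toUnit a 0 ^ 2 - 1) ≤ √(toUnit a (-u) ^ 2 - 1) := by
    apply Real.sqrt_le_sqrt; gcongr
  have he : (1 + a) / (1 - a) * (1 + 2 / (1 + a) ^ 2 * u)
      = (1 + a) / (1 - a) + 2 / (1 - a ^ 2) * u := by
    rw [show 1 - a ^ 2 = (1 - a) * (1 + a) by ring]; field_simp
  rw [he]
  linarith

/-- Supplies the majorant for the error integrals: integrability for s < m and, after rescaling,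
dominated convergence. -/
theorem eval_neg_extremalPoly_ge {a u : ℝ} (ha0 : 0 < a) (ha1 : a < 1) (m : ℕ) (hu : 0 ≤ u) :
    (extremalPoly a m).eval 0 * (1 + 2 / (1 + a) ^ 2 * u) ^ (m + 1)
      ≤ (extremalPoly a m).eval (-u) := by
  have h1 : 0 < 1 - a := by linarith
  have hz := exp_greenFun_neg_ge ha0 ha1 hu
  have hρ : (1 + a) / (1 - a) ≤ Real.exp (greenFun a (-u)) := by
    refine le_trans ?_ hz
    apply le_mul_of_one_le_right (by positivity)
    have : 0 ≤ 2 / (1 + a) ^ 2 * u := by positivity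
    linarith
  rw [eval_extremalPoly_eq_exp (t := -u) ha0 ha1 m (by nlinarith), eval_zero_extremalPoly ha0 ha1]
  have hexp : Real.exp ((m + 1) * greenFun a (-u)) = Real.exp (greenFun a (-u)) ^ (m + 1) := by
    rw [← Real.exp_nat_mul]; push_cast; rfl
  have hinv : Real.exp (-greenFun a (-u)) ≤ (1 - a) / (1 + a) := by
    rw [Real.exp_neg, ← inv_div]; gcongr
  have h3 := ratio_sub_inv_pos ha0 ha1
  have h4 : ((1 + a) / (1 - a)) ^ (m + 1) * (1 + 2 / (1 + a) ^ 2 * u) ^ (m + 1)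
      ≤ Real.exp (greenFun a (-u)) ^ (m + 1) := by
    rw [← mul_pow]; gcongr
  have h5 : ((1 + a) / (1 - a) - (1 - a) / (1 + a)) ^ 2
      ≤ ((1 + a) / (1 - a) - Real.exp (-greenFun a (-u))) ^ 2 := by gcongr
  have h6 := mul_le_mul h4 h5 (by positivity) (by positivity)
  have h7 : 0 ≤ Real.exp (-((m + 1) * greenFun a (-u)))
    * ((1 + a) / (1 - a) - Real.exp (greenFun a (-u))) ^ 2 := by positivity
  rw [hexp]
  linarith

theorem eval_neg_extremalPoly_pos {a u : ℝ} (ha0 : 0 < a) (ha1 : a < 1) (m : ℕ) (hu : 0 ≤ u) :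
    0 < (extremalPoly a m).eval (-u) := by
  refine lt_of_lt_of_le ?_ (eval_neg_extremalPoly_ge ha0 ha1 m hu)
  have := eval_zero_extremalPoly_pos ha0 ha1 m
  positivity

/-- The slope -1/a is what fixes the local scale a/m. -/
theorem hasDerivAt_greenFun_zero {a : ℝ} (ha0 : 0 < a) (ha1 : a < 1) :
    HasDerivAt (greenFun a) (-(1 / a)) 0 := by
  have h2 : 0 < 1 - a ^ 2 := by nlinarith
  have h1 : HasDerivAt (toUnit a) (-(2 / (1 - a ^ 2))) 0 := by
    have := (((hasDerivAt_id (0 : ℝ)).const_mul 2).const_sub (1 + a ^ 2)).div_const (1 - a ^ 2)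
    exact this.congr_deriv (by ring)
  have h := (Real.hasDerivAt_arcosh (one_lt_toUnit ha0 ha1 (by positivity : (0 : ℝ) < a ^ 2))).comp
    (0 : ℝ) h1
  refine h.congr_deriv ?_
  have : toUnit a 0 ^ 2 - 1 = (2 * a / (1 - a ^ 2)) ^ 2 := by
    unfold toUnit; field_simp; ring
  rw [this, Real.sqrt_sq (by positivity)]
  field_simp

/-- A general filter is allowed so that m and the evaluation point can vary together. The shift b is
1 for the extremal polynomial and 0 for the Chebyshev growth bound. -/
theorem tendsto_mul_greenFun_sub {a : ℝ} (ha0 : 0 < a) (ha1 : a < 1) {ι : Type*} {l : Filter ι}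
    {N : ι → ℕ} (hN : Tendsto N l atTop) {τ : ι → ℝ} {τ₀ : ℝ} (hτ : Tendsto τ l (𝓝 τ₀)) (b : ℝ) :
    Tendsto (fun i => ((N i : ℝ) + b) * (greenFun a (a * τ i / N i) - greenFun a 0)) l
      (𝓝 (-τ₀)) := by
  have hNr : Tendsto (fun i => (N i : ℝ)) l atTop := tendsto_natCast_atTop_atTop.comp hN
  have hinv : Tendsto (fun i => (N i : ℝ)⁻¹) l (𝓝 0) := tendsto_inv_atTop_zero.comp hNr
  have ht : Tendsto (fun i => a * τ i / N i) l (𝓝 0) := by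
    simpa [div_eq_mul_inv] using (hτ.const_mul a).mul hinv
  have hd := hasDerivAt_greenFun_zero ha0 ha1
  -- `dslope` equals the derivative at 0, so vanishing τ needs no separate case.
  have hs : Tendsto (fun i => dslope (greenFun a) 0 (a * τ i / N i)) l (𝓝 (-(1 / a))) := by
    have h := (continuousAt_dslope_same.2 hd.differentiableAt).tendsto
    rw [dslope_same, hd.deriv] at h
    exact h.comp ht
  have hm : Tendsto (fun i => (1 + b * (N i : ℝ)⁻¹) * (a * τ i)) l (𝓝 ((1 + b * 0) * (a * τ₀))) :=
    ((hinv.const_mul b).const_add 1).mul (hτ.const_mul a)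
  have h := hm.mul hs
  have he : (1 + b * 0) * (a * τ₀) * (-(1 / a)) = -τ₀ := by field_simp; ring
  rw [he] at h
  refine h.congr' ?_
  filter_upwards [hN.eventually_gt_atTop 0] with i hi
  have hi' : (N i : ℝ) ≠ 0 := by exact_mod_cast hi.ne'
  have := sub_smul_dslope (greenFun a) 0 (a * τ i / N i)
  rw [← this, sub_zero, smul_eq_mul]
  field_simp

theorem tendsto_eval_extremalPoly_div {a : ℝ} (ha0 : 0 < a) (ha1 : a < 1) {ι : Type*}
    {l : Filter ι} {N : ι → ℕ} (hN : Tendsto N l atTop) {τ : ι → ℝ} {τ₀ : ℝ}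
    (hτ : Tendsto τ l (𝓝 τ₀)) :
    Tendsto (fun i => (extremalPoly a (N i)).eval (a * τ i / N i) / (extremalPoly a (N i)).eval 0) l
      (𝓝 (Real.exp (-τ₀))) := by
  have hNr : Tendsto (fun i => (N i : ℝ)) l atTop := tendsto_natCast_atTop_atTop.comp hN
  have hinv : Tendsto (fun i => (N i : ℝ)⁻¹) l (𝓝 0) := tendsto_inv_atTop_zero.comp hNr
  have ht : Tendsto (fun i => a * τ i / N i) l (𝓝 0) := by
    simpa [div_eq_mul_inv] using (hτ.const_mul a).mul hinv
  have hG : Tendsto (fun i => greenFun a (a * τ i / N i)) l (𝓝 (greenFun a 0)) :=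
    (hasDerivAt_greenFun_zero ha0 ha1).continuousAt.tendsto.comp ht
  have hG0 : 0 < greenFun a 0 := Real.arcosh_pos (one_lt_toUnit ha0 ha1 (by positivity))
  have hr := ratio_sub_inv_pos ha0 ha1
  have h1 : 0 < 1 - a := by linarith
  set ρ := (1 + a) / (1 - a) with hρ
  have hρ0 : 0 < ρ := by positivity
  have hE1 := (Real.continuous_exp.tendsto _).comp (tendsto_mul_greenFun_sub ha0 ha1 hN hτ 1)
  have hE2 : Tendsto (fun i => Real.exp (-(((N i : ℝ) + 1) *
      (greenFun a (a * τ i / N i) + greenFun a 0)))) l (𝓝 0) := by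
    refine Real.tendsto_exp_neg_atTop_nhds_zero.comp ?_
    exact (tendsto_atTop_add_const_right _ 1 hNr).atTop_mul_pos
      (show 0 < greenFun a 0 + greenFun a 0 by linarith) (hG.add_const _)
  have hA : Tendsto (fun i => (ρ - Real.exp (-greenFun a (a * τ i / N i))) ^ 2) l
      (𝓝 ((ρ - (1 - a) / (1 + a)) ^ 2)) := by
    rw [← exp_neg_greenFun_zero ha0 ha1]
    exact (((Real.continuous_exp.tendsto _).comp hG.neg).const_sub ρ).pow 2
  have hB : Tendsto (fun i => (ρ - Real.exp (greenFun a (a * τ i / N i))) ^ 2) l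
      (𝓝 ((ρ - Real.exp (greenFun a 0)) ^ 2)) :=
    (((Real.continuous_exp.tendsto _).comp hG).const_sub ρ).pow 2
  have h := ((hE1.mul hA).add (hE2.mul hB)).div_const ((ρ - (1 - a) / (1 + a)) ^ 2)
  rw [zero_mul, add_zero, mul_div_cancel_right₀ _ (by positivity)] at h
  refine h.congr' ?_
  filter_upwards [ht.eventually_lt_const (show (0 : ℝ) < a ^ 2 by positivity)] with i hi
  rw [eval_extremalPoly_eq_exp ha0 ha1 _ hi, eval_zero_extremalPoly ha0 ha1]
  have e1 : ρ ^ (N i + 1) = Real.exp (((N i : ℝ) + 1) * greenFun a 0) := by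
    rw [hρ, ← exp_greenFun_zero ha0 ha1, ← Real.exp_nat_mul]; push_cast; rfl
  simp only [Function.comp_apply]
  rw [← hρ, e1, mul_sub, mul_add ((N i : ℝ) + 1), neg_add, Real.exp_sub, Real.exp_add,
    Real.exp_neg (((N i : ℝ) + 1) * greenFun a 0)]
  have := Real.exp_pos (((N i : ℝ) + 1) * greenFun a 0)
  field_simp

/-! ### Integral representation of the interpolation error -/

section
open MeasureTheory Set

/-- Integrating in u first leaves Γ(σ) y^{-σ} e^{-ty}, integrable at 0 because σ < 1. -/
theorem integrable_rpow_mul_exp_prod {σ t : ℝ} (h0 : 0 < σ) (h1 : σ < 1) (ht : 0 < t) :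
    Integrable (fun z : ℝ × ℝ => z.1 ^ (σ - 1) * Real.exp (-((t + z.1) * z.2)))
      ((volume.restrict (Ioi 0)).prod (volume.restrict (Ioi 0))) := by
  have hm : Measurable fun z : ℝ × ℝ => z.1 ^ (σ - 1) * Real.exp (-((t + z.1) * z.2)) := by
    fun_prop
  have hsec : ∀ y ∈ Ioi (0 : ℝ), ∀ u, u ^ (σ - 1) * Real.exp (-((t + u) * y))
      = u ^ (σ - 1) * Real.exp (-(y * u)) * Real.exp (-(t * y)) := by
    intro y _ u
    rw [mul_assoc, ← Real.exp_add]; ring_nf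
  have hInt : ∀ y ∈ Ioi (0 : ℝ),
      IntegrableOn (fun u => u ^ (σ - 1) * Real.exp (-(y * u))) (Ioi 0) := by
    intro y hy
    have := integrableOn_rpow_mul_exp_neg_mul_rpow (s := σ - 1) (p := 1) (by linarith) one_pos hy
    simpa using this
  rw [integrable_prod_iff' hm.aestronglyMeasurable]
  constructor
  · refine (ae_restrict_mem measurableSet_Ioi).mono fun y hy => ?_
    simp only [hsec y hy]
    exact (hInt y hy).mul_const _
  · have hG : IntegrableOn (fun y => Real.Gamma σ * (y ^ (-σ) * Real.exp (-(t * y)))) (Ioi 0) := by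
      have := integrableOn_rpow_mul_exp_neg_mul_rpow (s := -σ) (p := 1) (by linarith) one_pos ht
      simpa [IntegrableOn] using this.const_mul (Real.Gamma σ)
    refine hG.congr_fun (fun y hy => ?_) measurableSet_Ioi
    have hnorm : ∀ u ∈ Ioi (0 : ℝ), ‖u ^ (σ - 1) * Real.exp (-((t + u) * y))‖
        = u ^ (σ - 1) * Real.exp (-(y * u)) * Real.exp (-(t * y)) := by
      intro u hu
      rw [Real.norm_of_nonneg, hsec y hy]
      have := Real.rpow_nonneg (le_of_lt hu) (σ - 1)
      positivity
    simp only
    rw [setIntegral_congr_fun measurableSet_Ioi hnorm, integral_mul_const,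
      Real.integral_rpow_mul_exp_neg_mul_Ioi h0 hy, one_div, Real.inv_rpow (le_of_lt hy),
      Real.rpow_neg (le_of_lt hy)]
    ring

theorem rpow_div_add_eq_integral {σ t u : ℝ} (ht : 0 < t) (hu : 0 < u) :
    ∫ y in Ioi (0 : ℝ), u ^ (σ - 1) * Real.exp (-((t + u) * y)) = u ^ (σ - 1) / (t + u) := by
  rw [integral_const_mul]
  have h := integral_exp_mul_Ioi (a := -(t + u)) (by linarith) 0
  simp only [neg_mul] at h
  rw [h, mul_zero, neg_zero, Real.exp_zero, neg_div_neg_eq, mul_one_div]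

theorem integrableOn_rpow_sub_one_div_add {σ t : ℝ} (h0 : 0 < σ) (h1 : σ < 1) (ht : 0 < t) :
    IntegrableOn (fun u : ℝ => u ^ (σ - 1) / (t + u)) (Ioi 0) :=
  IntegrableOn.congr_fun (integrable_rpow_mul_exp_prod h0 h1 ht).integral_prod_left
    (fun _ hu => rpow_div_add_eq_integral ht hu) measurableSet_Ioi

/-- Writing 1/(t+u) = ∫ e^{-(t+u)y} dy and exchanging the integrals gives Γ(σ)Γ(1-σ) t^{σ-1}; the
reflection formula finishes. -/
theorem integral_rpow_sub_one_div_add {σ t : ℝ} (h0 : 0 < σ) (h1 : σ < 1) (ht : 0 < t) :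
    ∫ u in Ioi (0 : ℝ), u ^ (σ - 1) / (t + u) = Real.pi / Real.sin (Real.pi * σ) * t ^ (σ - 1) := by
  rw [← setIntegral_congr_fun measurableSet_Ioi
    (fun u hu => rpow_div_add_eq_integral (σ := σ) ht hu),
    integral_integral_swap (integrable_rpow_mul_exp_prod h0 h1 ht)]
  have hin : ∀ y ∈ Ioi (0 : ℝ), ∫ u in Ioi (0 : ℝ), u ^ (σ - 1) * Real.exp (-((t + u) * y))
      = Real.Gamma σ * (y ^ ((1 - σ) - 1) * Real.exp (-(t * y))) := by
    intro y hy
    have : ∀ u, u ^ (σ - 1) * Real.exp (-((t + u) * y))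
        = u ^ (σ - 1) * Real.exp (-(y * u)) * Real.exp (-(t * y)) := by
      intro u
      rw [mul_assoc, ← Real.exp_add]; ring_nf
    simp only [this]
    rw [integral_mul_const, Real.integral_rpow_mul_exp_neg_mul_Ioi h0 hy, one_div,
      Real.inv_rpow (le_of_lt hy), show 1 - σ - 1 = -σ by ring, Real.rpow_neg (le_of_lt hy)]
    ring
  rw [setIntegral_congr_fun measurableSet_Ioi hin, integral_const_mul,
    Real.integral_rpow_mul_exp_neg_mul_Ioi (by linarith) ht, ← Real.Gamma_mul_Gamma_one_sub,
    one_div, Real.inv_rpow ht.le, ← Real.rpow_neg ht.le]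
  ring_nf

/-- An integral of polynomials of degree at most `m` is a polynomial of degree at most `m`. -/
theorem exists_polynomial_eval_eq_integral {F : ℝ → ℝ → ℝ} {m : ℕ}
    (hF : ∀ u > 0, ∃ B : ℝ[X], B.natDegree ≤ m ∧ ∀ t > 0, B.eval t = F u t)
    (hInt : ∀ t > 0, IntegrableOn (fun u => F u t) (Ioi 0)) :
    ∃ Q : ℝ[X], Q.natDegree ≤ m ∧ ∀ t > 0, Q.eval t = ∫ u in Ioi (0 : ℝ), F u t := by
  -- Interpolating at fixed positive nodes replaces integration of coefficients by integration of
  -- the values F u (v i).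
  set v : ℕ → ℝ := fun j => j + 1 with hv
  have hv0 : ∀ j, 0 < v j := fun j => by positivity
  have hinj : Set.InjOn v (Finset.range (m + 1)) := fun i _ j _ h => by simpa [hv] using h
  have hb : ∀ i ∈ Finset.range (m + 1),
      (Lagrange.basis (Finset.range (m + 1)) v i).natDegree ≤ m := by
    intro i hi
    rw [Lagrange.natDegree_basis hinj hi]; simp
  refine ⟨∑ i ∈ Finset.range (m + 1), C (∫ u in Ioi (0 : ℝ), F u (v i)) *
    Lagrange.basis (Finset.range (m + 1)) v i, natDegree_sum_le_of_forall_le _ _ fun i hi =>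
      (natDegree_C_mul_le _ _).trans (hb i hi), fun t ht => ?_⟩
  have key : ∀ u ∈ Ioi (0 : ℝ), F u t = ∑ i ∈ Finset.range (m + 1),
      F u (v i) * (Lagrange.basis (Finset.range (m + 1)) v i).eval t := by
    intro u hu
    obtain ⟨B, hBd, hB⟩ := hF u hu
    have hdeg : B.degree < (Finset.range (m + 1)).card := by
      rw [Finset.card_range]
      exact lt_of_le_of_lt (natDegree_le_iff_degree_le.1 hBd) (by exact_mod_cast Nat.lt_succ_self m)
    have h := congrArg (eval t) (Lagrange.eq_interpolate hinj hdeg)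
    rw [Lagrange.interpolate_apply, eval_finsetSum, hB t ht] at h
    rw [h]
    refine Finset.sum_congr rfl fun i _ => ?_
    rw [eval_mul, eval_C, hB _ (hv0 i)]
  rw [setIntegral_congr_fun measurableSet_Ioi key, integral_finsetSum, eval_finsetSum]
  · refine Finset.sum_congr rfl fun i _ => ?_
    rw [integral_mul_const, eval_mul, eval_C]
  · exact fun i _ => (hInt _ (hv0 i)).mul_const _

/-- The multiple of S is chosen to cancel (-u)^{k+1} = -(-1)^k u^{k+1} at t = -u, so t + u divides
the right-hand side. -/
theorem exists_divided_difference {S : ℝ[X]} {m k : ℕ} (hS : S.natDegree ≤ m + 1) (hk : k ≤ m)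
    {u : ℝ} (hSu : S.eval (-u) ≠ 0) :
    ∃ B : ℝ[X], B.natDegree ≤ m ∧
      ∀ t, (t + u) * B.eval t = t ^ (k + 1) + (-1) ^ k * u ^ (k + 1) * (S.eval t / S.eval (-u)) := by
  set A : ℝ[X] := X ^ (k + 1) + C ((-1) ^ k * u ^ (k + 1) / S.eval (-u)) * S with hA
  have hAd : A.natDegree ≤ m + 1 := natDegree_add_le_of_degree_le
    ((natDegree_X_pow _).le.trans (by omega)) ((natDegree_C_mul_le _ _).trans hS)
  have hroot : A.IsRoot (-u) := by
    simp only [hA, IsRoot, eval_add, eval_pow, eval_X, eval_mul, eval_C]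
    rw [div_mul_cancel₀ _ hSu, neg_pow, pow_succ]; ring
  refine ⟨A /ₘ (X - C (-u)), ?_, fun t => ?_⟩
  · rw [natDegree_divByMonic _ (monic_X_sub_C _), natDegree_X_sub_C]; omega
  · have h := congrArg (eval t) (mul_divByMonic_eq_iff_isRoot.2 hroot)
    simp only [eval_mul, eval_sub, eval_X, eval_C, sub_neg_eq_add] at h
    rw [h]
    simp [hA]
    ring

theorem integrableOn_rpow_mul_error_kernel {S : ℝ[X]} {s t : ℝ} (ht : 0 < t)
    (hS : ∀ u, 0 ≤ u → 0 < S.eval (-u))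
    (hInt : IntegrableOn (fun u : ℝ => u ^ s / S.eval (-u)) (Ioi 0)) :
    IntegrableOn (fun u : ℝ => u ^ s * (S.eval t / (S.eval (-u) * (t + u)))) (Ioi 0) := by
  have hm : Measurable fun u : ℝ => S.eval (-u) := (by fun_prop : Continuous _).measurable
  refine Integrable.mono' (hInt.mul_const (|S.eval t| / t)) (by fun_prop) ?_
  refine (ae_restrict_mem measurableSet_Ioi).mono fun u hu => ?_
  have hu' : 0 < u := hu
  have h1 := hS u hu'.le
  have h2 := Real.rpow_nonneg hu'.le s
  rw [Real.norm_eq_abs, abs_mul, abs_div, abs_mul, abs_of_nonneg h2, abs_of_pos h1,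
    abs_of_pos (by linarith : 0 < t + u), div_mul_div_comm, mul_div_assoc]
  gcongr
  linarith

/-- The interpolation polynomial of `t ^ s` at the zeros of `S`, given by its error. -/
theorem exists_interpolation_polynomial {S : ℝ[X]} {m : ℕ} {s : ℝ} (hs : 0 < s)
    (hsn : ∀ n : ℕ, s ≠ n) (hsm : s < m) (hSd : S.natDegree ≤ m + 1)
    (hS : ∀ u, 0 ≤ u → 0 < S.eval (-u))
    (hInt : IntegrableOn (fun u : ℝ => u ^ s / S.eval (-u)) (Ioi 0)) :
    ∃ Q : ℝ[X], Q.natDegree ≤ m ∧ ∀ t > 0, Q.eval t = t ^ s + Real.sin (Real.pi * s) / Real.pi *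
      ∫ u in Ioi (0 : ℝ), u ^ s * (S.eval t / (S.eval (-u) * (t + u))) := by
  set k := ⌊s⌋₊ with hk
  obtain ⟨σ, hσ⟩ : ∃ σ, s = σ + k := ⟨s - k, by ring⟩
  have hσ0 : 0 < σ := by
    have h1 := Nat.floor_le hs.le
    have h2 := hsn k
    rw [← hk] at h1
    rcases h1.lt_or_eq with h | h
    · linarith
    · exact absurd h.symm h2
  have hσ1 : σ < 1 := by have := Nat.lt_floor_add_one s; rw [← hk] at this; linarith
  have hkm : k ≤ m := by
    have : (k : ℝ) < m := by linarith
    exact_mod_cast this.le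
  have hsin : Real.sin (Real.pi * s) = (-1) ^ k * Real.sin (Real.pi * σ) := by
    rw [hσ, mul_add, mul_comm Real.pi (k : ℝ), Real.sin_add_nat_mul_pi]
  have hsinpos : 0 < Real.sin (Real.pi * σ) :=
    Real.sin_pos_of_pos_of_lt_pi (by positivity) (by nlinarith [Real.pi_pos])
  -- With s = k + σ, the first term integrates to t^{k+1} t^{σ-1} = t^s. The second, using sin πs =
  -- (-1)^k sin πσ, makes the integrand a polynomial in t for each u.
  set F : ℝ → ℝ → ℝ := fun u t => Real.sin (Real.pi * σ) / Real.pi * t ^ (k + 1)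
      * (u ^ (σ - 1) / (t + u)) + Real.sin (Real.pi * s) / Real.pi *
        (u ^ s * (S.eval t / (S.eval (-u) * (t + u)))) with hF
  have hi1 : ∀ t > 0, IntegrableOn (fun u => Real.sin (Real.pi * σ) / Real.pi * t ^ (k + 1)
      * (u ^ (σ - 1) / (t + u))) (Ioi 0) := fun t ht =>
    (integrableOn_rpow_sub_one_div_add hσ0 hσ1 ht).const_mul _
  have hi2 : ∀ t > 0, IntegrableOn (fun u => Real.sin (Real.pi * s) / Real.pi *
      (u ^ s * (S.eval t / (S.eval (-u) * (t + u))))) (Ioi 0) := fun t ht =>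
    (integrableOn_rpow_mul_error_kernel ht hS hInt).const_mul _
  have hpoly : ∀ u > 0, ∃ B : ℝ[X], B.natDegree ≤ m ∧ ∀ t > 0, B.eval t = F u t := by
    intro u hu
    obtain ⟨B, hBd, hB⟩ := exists_divided_difference hSd hkm (hS u hu.le).ne'
    refine ⟨C (Real.sin (Real.pi * σ) / Real.pi * u ^ (σ - 1)) * B,
      (natDegree_C_mul_le _ _).trans hBd, fun t ht => ?_⟩
    have h1 : B.eval t = (t ^ (k + 1) + (-1) ^ k * u ^ (k + 1) * (S.eval t / S.eval (-u)))
        / (t + u) := by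
      rw [← hB t, mul_div_cancel_left₀ _ (by positivity)]
    have h2 : u ^ s = u ^ (k + 1) * u ^ (σ - 1) := by
      rw [show s = (k + 1 : ℕ) + (σ - 1) by rw [hσ]; push_cast; ring, Real.rpow_add hu,
        Real.rpow_natCast]
    have h3 := hS u hu.le
    simp only [hF]
    rw [eval_mul, eval_C, h1, h2, hsin]
    have h4 : t + u ≠ 0 := by positivity
    field_simp
  obtain ⟨Q, hQd, hQ⟩ := exists_polynomial_eval_eq_integral (F := F) (m := m) hpoly
    (fun t ht => (hi1 t ht).add (hi2 t ht))
  refine ⟨Q, hQd, fun t ht => ?_⟩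
  rw [hQ t ht, integral_add (hi1 t ht) (hi2 t ht), integral_const_mul, integral_const_mul,
    integral_rpow_sub_one_div_add hσ0 hσ1 ht]
  congr 1
  rw [show s = (k + 1 : ℕ) + (σ - 1) by rw [hσ]; push_cast; ring, Real.rpow_add ht,
    Real.rpow_natCast]
  have := Real.pi_pos
  field_simp

theorem integrableOn_rpow_mul_one_add_mul_pow_inv {s c : ℝ} (hs : 0 ≤ s) (hc : 0 < c) {k : ℕ}
    (hk : s + 1 < k) : IntegrableOn (fun v : ℝ => v ^ s * ((1 + c * v) ^ k)⁻¹) (Ioi 0) := by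
  have hI : IntegrableOn (fun v : ℝ => c ^ (-s) * c ^ (s - k) * (v + c⁻¹) ^ (s - k)) (Ioi 0) :=
    (integrableOn_add_rpow_Ioi_of_lt (a := s - k) (c := 0) (m := c⁻¹) (by linarith)
      (by simpa using hc)).const_mul _
  refine Integrable.mono' hI (by fun_prop) ?_
  refine (ae_restrict_mem measurableSet_Ioi).mono fun v hv => ?_
  have hv' : 0 < v := hv
  have h1 : 0 < 1 + c * v := by positivity
  have h2 : c ^ (s - k) * (v + c⁻¹) ^ (s - k) = (1 + c * v) ^ (s - k) := by
    rw [← Real.mul_rpow hc.le (by positivity)]; congr 1; field_simp; ring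
  have h3 : v ^ s ≤ c ^ (-s) * (1 + c * v) ^ s := by
    rw [Real.rpow_neg hc.le, ← Real.inv_rpow hc.le, ← Real.mul_rpow (by positivity) h1.le]
    apply Real.rpow_le_rpow hv'.le _ hs
    rw [mul_add, inv_mul_cancel_left₀ hc.ne']
    simp [hc.le]
  rw [Real.norm_of_nonneg (by have := Real.rpow_nonneg hv'.le s; positivity), mul_assoc, h2,
    Real.rpow_sub h1, Real.rpow_natCast, div_eq_mul_inv, ← mul_assoc]
  gcongr

/-- `(1 + x / m) ^ m` increases with `m`. -/
theorem one_add_div_pow_le_one_add_div_pow {x : ℝ} (hx : 0 ≤ x) {k m : ℕ} (hk : 0 < k)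
    (hkm : k ≤ m) : (1 + x / k) ^ k ≤ (1 + x / m) ^ m := by
  have hk' : (0 : ℝ) < k := by exact_mod_cast hk
  have hm' : (0 : ℝ) < m := by exact_mod_cast hk.trans_le hkm
  have h := one_add_mul_self_le_rpow_one_add (s := x / m) (p := m / k)
    (by linarith [show 0 ≤ x / m by positivity]) (by rw [le_div_iff₀ hk']; simpa using hkm)
  have h1 : (m : ℝ) / k * (x / m) = x / k := by field_simp
  rw [h1] at h
  calc (1 + x / k) ^ k ≤ ((1 + x / m) ^ ((m : ℝ) / k)) ^ k := by gcongr
    _ = (1 + x / m) ^ m := by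
      rw [← Real.rpow_natCast, ← Real.rpow_mul (by positivity), div_mul_cancel₀ _ hk'.ne',
        Real.rpow_natCast]

end

/-! ### Asymptotics of the error integrals -/

section
open MeasureTheory Set

theorem integrableOn_rpow_div_extremalPoly {a s : ℝ} (ha0 : 0 < a) (ha1 : a < 1) (hs : 0 ≤ s)
    {m : ℕ} (hm : s < m) :
    IntegrableOn (fun u : ℝ => u ^ s / (extremalPoly a m).eval (-u)) (Ioi 0) := by
  have h0 := eval_zero_extremalPoly_pos ha0 ha1 m
  have hI := (integrableOn_rpow_mul_one_add_mul_pow_inv hs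
    (show 0 < 2 / (1 + a) ^ 2 by positivity) (k := m + 1) (by push_cast; linarith)).const_mul
      ((extremalPoly a m).eval 0)⁻¹
  have hmeas : Measurable fun u : ℝ => (extremalPoly a m).eval (-u) :=
    (by fun_prop : Continuous _).measurable
  refine Integrable.mono' hI (Measurable.aestronglyMeasurable (by fun_prop)) ?_
  refine (ae_restrict_mem measurableSet_Ioi).mono fun u hu => ?_
  have hu' : 0 < u := hu
  have h1 := eval_neg_extremalPoly_ge ha0 ha1 m hu'.le
  have h2 := eval_neg_extremalPoly_pos ha0 ha1 m hu'.le
  have h3 := Real.rpow_nonneg hu'.le s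
  rw [Real.norm_of_nonneg (by positivity), mul_left_comm, ← mul_inv, div_eq_mul_inv]
  gcongr

theorem exists_interpolation_extremalPoly {a s : ℝ} (ha0 : 0 < a) (ha1 : a < 1) (hs : 0 < s)
    (hsn : ∀ n : ℕ, s ≠ n) {m : ℕ} (hm : s < m) :
    ∃ Q : ℝ[X], Q.natDegree ≤ m ∧ ∀ t > 0, Q.eval t = t ^ s + Real.sin (Real.pi * s) / Real.pi *
      ((extremalPoly a m).eval t *
        ∫ u in Ioi (0 : ℝ), u ^ s * (((extremalPoly a m).eval (-u))⁻¹ * (t + u)⁻¹)) := by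
  obtain ⟨Q, hQd, hQ⟩ := exists_interpolation_polynomial hs hsn hm (natDegree_extremalPoly_le a m)
    (fun u hu => eval_neg_extremalPoly_pos ha0 ha1 m hu)
    (integrableOn_rpow_div_extremalPoly ha0 ha1 hs.le hm)
  refine ⟨Q, hQd, fun t ht => ?_⟩
  rw [hQ t ht, ← integral_const_mul ((extremalPoly a m).eval t)]
  congr 2
  refine integral_congr_ae (Eventually.of_forall fun u => ?_)
  simp only [div_eq_mul_inv, mul_inv]
  ring

theorem integral_rpow_mul_eq_rescale (s : ℝ) (g : ℝ → ℝ) {b : ℝ} (hb : 0 < b) :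
    ∫ u in Ioi (0 : ℝ), u ^ s * g u = b ^ (s + 1) * ∫ v in Ioi (0 : ℝ), v ^ s * g (b * v) := by
  have h := integral_comp_mul_left_Ioi (fun u : ℝ => u ^ s * g u) 0 hb
  rw [mul_zero, smul_eq_mul, inv_eq_one_div, eq_comm, one_div_mul_eq_div, div_eq_iff hb.ne'] at h
  rw [h, Real.rpow_add_one hb.ne', mul_comm (b ^ s) b, mul_assoc, ← integral_const_mul (b ^ s),
    mul_comm]
  congr 1
  refine setIntegral_congr_fun measurableSet_Ioi fun v hv => ?_
  rw [Real.mul_rpow hb.le (le_of_lt hv)]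
  ring

/-- The rescaled reciprocal of the extremal polynomial converges to `exp (-v)` under integrals. -/
theorem tendsto_integral_rpow_mul_extremalPoly {a s : ℝ} (ha0 : 0 < a) (ha1 : a < 1) (hs : 0 ≤ s)
    {ι : Type*} {l : Filter ι} [l.IsCountablyGenerated] {N : ι → ℕ} (hN : Tendsto N l atTop)
    {w : ι → ℝ → ℝ} {w₀ : ℝ → ℝ} {M : ℝ} (hwm : ∀ i, Measurable (w i))
    (hwb : ∀ᶠ i in l, ∀ v > 0, |w i v| ≤ M) (hw : ∀ v > 0, Tendsto (fun i => w i v) l (𝓝 (w₀ v))) :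
    Tendsto (fun i => ∫ v in Ioi (0 : ℝ), v ^ s * ((extremalPoly a (N i)).eval 0
      * ((extremalPoly a (N i)).eval (-(a / N i * v)))⁻¹ * w i v)) l
      (𝓝 (∫ v in Ioi (0 : ℝ), v ^ s * (Real.exp (-v) * w₀ v))) := by
  -- Since (1 + x/m)^m increases with m, one fixed exponent k > s + 1 gives an integrable majorant
  -- for all later indices.
  obtain ⟨k, hk⟩ := exists_nat_gt (s + 1)
  have hk0 : 0 < k := by
    have : (0 : ℝ) < k := by linarith
    exact_mod_cast this
  have hk0' : (0 : ℝ) < k := by exact_mod_cast hk0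
  have hc : 0 < 2 / (1 + a) ^ 2 * a / k := by positivity
  refine tendsto_integral_filter_of_dominated_convergence
    (fun v => v ^ s * ((1 + 2 / (1 + a) ^ 2 * a / k * v) ^ k)⁻¹ * M) ?_ ?_
    ((integrableOn_rpow_mul_one_add_mul_pow_inv hs hc hk).mul_const M) ?_
  · refine Eventually.of_forall fun i => Measurable.aestronglyMeasurable ?_
    have hmeas : Measurable fun v : ℝ => (extremalPoly a (N i)).eval (-(a / N i * v)) :=
      (by fun_prop : Continuous _).measurable
    have := hwm i
    fun_prop
  · filter_upwards [hwb, hN.eventually_ge_atTop k] with i hi hki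
    refine (ae_restrict_mem measurableSet_Ioi).mono fun v hv => ?_
    have hv' : 0 < v := hv
    have hN0 : (0 : ℝ) < N i := by exact_mod_cast hk0.trans_le hki
    have h0 := eval_zero_extremalPoly_pos ha0 ha1 (N i)
    have hu : 0 ≤ a / N i * v := by positivity
    have h1 := eval_neg_extremalPoly_ge ha0 ha1 (N i) hu
    have h2 := eval_neg_extremalPoly_pos ha0 ha1 (N i) hu
    have h3 := Real.rpow_nonneg hv'.le s
    have h4 := one_add_div_pow_le_one_add_div_pow (x := 2 / (1 + a) ^ 2 * a * v) (by positivity)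
      hk0 hki
    have h5 : (1 + 2 / (1 + a) ^ 2 * a / k * v) ^ k
        ≤ (1 + 2 / (1 + a) ^ 2 * (a / N i * v)) ^ (N i + 1) := by
      have e1 : 2 / (1 + a) ^ 2 * a / k * v = 2 / (1 + a) ^ 2 * a * v / k := by ring
      have e2 : 2 / (1 + a) ^ 2 * (a / N i * v) = 2 / (1 + a) ^ 2 * a * v / N i := by ring
      rw [e1, e2]
      refine h4.trans (pow_le_pow_right₀ ?_ (Nat.le_succ _))
      have : 0 ≤ 2 / (1 + a) ^ 2 * a * v / N i := by positivity
      linarith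
    have h6 : (extremalPoly a (N i)).eval 0 * ((extremalPoly a (N i)).eval (-(a / N i * v)))⁻¹
        ≤ ((1 + 2 / (1 + a) ^ 2 * a / k * v) ^ k)⁻¹ := by
      rw [← div_eq_mul_inv, div_le_iff₀ h2, ← div_eq_inv_mul, le_div_iff₀ (by positivity)]
      exact (mul_le_mul_of_nonneg_left h5 h0.le).trans h1
    have hM : 0 ≤ M := (abs_nonneg _).trans (hi v hv')
    rw [Real.norm_eq_abs, abs_mul, abs_mul, abs_of_nonneg h3, abs_of_nonneg (by positivity),
      mul_assoc (v ^ s)]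
    gcongr
    exact hi v hv'
  · refine (ae_restrict_mem measurableSet_Ioi).mono fun v hv => ?_
    have h := tendsto_eval_extremalPoly_div ha0 ha1 hN (tendsto_const_nhds (x := -v))
    have h' := h.inv₀ (Real.exp_ne_zero _)
    rw [neg_neg, ← Real.exp_neg] at h'
    refine Tendsto.const_mul _ (Tendsto.mul ?_ (hw v hv))
    refine h'.congr fun i => ?_
    rw [inv_div, div_eq_mul_inv]
    congr 3
    ring

/-- The substitution v = μ² brings the limit to the form in which it arises in the variable t. -/
theorem limitFun_eq {p l : ℝ} (hl : 0 < l) : limitFun p l =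
    (l ^ 2) ^ (p / 2) + Real.sin (Real.pi * (p / 2)) / Real.pi * (Real.exp (-l ^ 2) *
      ∫ v in Ioi (0 : ℝ), v ^ (p / 2) * (Real.exp (-v) * (l ^ 2 + v)⁻¹)) := by
  have h2 : ∀ x : ℝ, 0 < x → (x ^ 2) ^ (p / 2) = x ^ p := by
    intro x hx
    rw [← Real.rpow_natCast, ← Real.rpow_mul hx.le]; congr 1; push_cast; ring
  rw [limitFun, h2 l hl, ← integral_const_mul (Real.exp (-l ^ 2)), mul_div_assoc,
    ← integral_comp_rpow_Ioi_of_pos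
    (g := fun v => Real.exp (-l ^ 2) * (v ^ (p / 2) * (Real.exp (-v) * (l ^ 2 + v)⁻¹)))
    (p := 2) two_pos]
  congr 2
  refine setIntegral_congr_fun measurableSet_Ioi fun μ hμ => ?_
  have hμ' : 0 < μ := hμ
  simp only [smul_eq_mul]
  rw [Real.rpow_two, h2 μ hμ', neg_add, Real.exp_add, show (2 : ℝ) - 1 = 1 by norm_num,
    Real.rpow_one, div_eq_mul_inv]
  ring

/-- Local limit of the interpolation polynomials. -/
theorem tendsto_rescaled_interpolation {a s : ℝ} (ha0 : 0 < a) (ha1 : a < 1) (hs : 0 ≤ s)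
    {ι : Type*} {l : Filter ι} [l.IsCountablyGenerated] {N : ι → ℕ} (hN : Tendsto N l atTop)
    {x : ι → ℝ} {x₀ : ℝ} (hx : Tendsto x l (𝓝 x₀)) (hx0 : 0 < x₀) {Q : ι → ℝ[X]} {K : ℝ}
    (hQ : ∀ᶠ i in l, ∀ t > 0, (Q i).eval t = t ^ s + K * ((extremalPoly a (N i)).eval t *
        ∫ u in Ioi (0 : ℝ), u ^ s * (((extremalPoly a (N i)).eval (-u))⁻¹ * (t + u)⁻¹))) :
    Tendsto (fun i => (N i / a) ^ s * (Q i).eval (a / N i * x i)) l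
      (𝓝 (x₀ ^ s + K * (Real.exp (-x₀) *
        ∫ v in Ioi (0 : ℝ), v ^ s * (Real.exp (-v) * (x₀ + v)⁻¹)))) := by
  have hI := tendsto_integral_rpow_mul_extremalPoly ha0 ha1 hs hN (w := fun i v => (x i + v)⁻¹)
    (w₀ := fun v => (x₀ + v)⁻¹) (M := (x₀ / 2)⁻¹) (fun i => by fun_prop) ?_ ?_
  · have hR := tendsto_eval_extremalPoly_div ha0 ha1 hN hx
    have hp : Tendsto (fun i => x i ^ s) l (𝓝 (x₀ ^ s)) := hx.rpow_const (Or.inl hx0.ne')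
    refine (hp.add ((hR.mul hI).const_mul K)).congr' ?_
    filter_upwards [hQ, hx.eventually_const_lt hx0, hN.eventually_gt_atTop 0] with i hi hxi hNi
    have hN0 : (0 : ℝ) < N i := by exact_mod_cast hNi
    set b := a / N i with hb
    have hb0 : 0 < b := by positivity
    have hS0 := eval_zero_extremalPoly_pos ha0 ha1 (N i)
    have e1 : a * x i / N i = b * x i := by rw [hb]; ring
    have e2 : (N i / a : ℝ) ^ s = (b ^ s)⁻¹ := by
      rw [← Real.inv_rpow hb0.le, hb, inv_div]
    -- After u = bv, the factor b^{s+1} from the integral and b⁻¹ from the kernel leave b^s, which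
    -- the normalization cancels.
    rw [hi _ (by positivity), integral_rpow_mul_eq_rescale s (fun u =>
      ((extremalPoly a (N i)).eval (-u))⁻¹ * (b * x i + u)⁻¹) hb0, e1, e2, mul_add,
      Real.mul_rpow hb0.le hxi.le, inv_mul_cancel_left₀ (Real.rpow_pos_of_pos hb0 s).ne']
    congr 1
    have e3 : ∀ v, v ^ s * (((extremalPoly a (N i)).eval (-(b * v)))⁻¹ * (b * x i + b * v)⁻¹)
        = (b⁻¹ * ((extremalPoly a (N i)).eval 0)⁻¹) * (v ^ s * ((extremalPoly a (N i)).eval 0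
        * ((extremalPoly a (N i)).eval (-(b * v)))⁻¹ * (x i + v)⁻¹)) := by
      intro v
      rw [← mul_add, mul_inv]
      field_simp
    simp only [e3]
    rw [integral_const_mul, Real.rpow_add_one hb0.ne']
    have := Real.rpow_pos_of_pos hb0 s
    field_simp
  · filter_upwards [hx.eventually_const_lt (show x₀ / 2 < x₀ by linarith)] with i hi v hv
    rw [abs_of_nonneg (by have : 0 < x i := by linarith
                          positivity)]
    gcongr
    linarith
  · intro v hv
    exact (hx.add_const v).inv₀ (by positivity)

/-- The weight w covers both bounds for the error: only its limit at the scale a/m matters. -/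
theorem tendsto_error_constant {a s : ℝ} (ha0 : 0 < a) (ha1 : a < 1) (hs : 0 < s)
    (hsn : ∀ n : ℕ, s ≠ n) {w : ℕ → ℝ → ℝ} (hwm : ∀ i, Measurable (w i))
    (hwb : ∀ i, ∀ v > 0, |w i (a / i * v)| ≤ 1)
    (hw : ∀ v > 0, Tendsto (fun i : ℕ => w i (a / i * v)) atTop (𝓝 1)) :
    Tendsto (fun m : ℕ => ((1 + a) / (1 - a)) ^ (m + 1) * (m : ℝ) ^ (s + 1) *
      (|Real.sin (Real.pi * s) / Real.pi| * (4 / (1 - a) ^ 2) *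
        ∫ u in Ioi (0 : ℝ), u ^ s * (((extremalPoly a m).eval (-u))⁻¹ * w m u))) atTop
      (𝓝 (a ^ (s - 1) * ((1 + a) ^ 2 / (2 * |Real.Gamma (-s)|)))) := by
  have h1 : 0 < 1 - a := by linarith
  have hI := tendsto_integral_rpow_mul_extremalPoly ha0 ha1 hs.le (N := fun m => m) tendsto_id
    (w := fun i v => w i (a / i * v)) (w₀ := fun _ => 1) (M := 1)
    (fun i => (hwm i).comp (by fun_prop)) (Eventually.of_forall hwb) hw
  have hG : ∫ v in Ioi (0 : ℝ), v ^ s * (Real.exp (-v) * 1) = Real.Gamma (s + 1) := by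
    rw [Real.Gamma_eq_integral (by linarith)]
    refine setIntegral_congr_fun measurableSet_Ioi fun v _ => ?_
    simp only [mul_one, add_sub_cancel_right]
    rw [mul_comm]
  rw [hG] at hI
  set ρ := (1 + a) / (1 - a) with hρ
  have hρ0 : 0 < ρ := by positivity
  set d := ρ - (1 - a) / (1 + a) with hd
  have hd0 : 0 < d := ratio_sub_inv_pos ha0 ha1
  have hlim := hI.const_mul (|Real.sin (Real.pi * s) / Real.pi| * (4 / (1 - a) ^ 2) *
    (a ^ (s + 1) * (2 / d ^ 2)))
  have hconst : |Real.sin (Real.pi * s) / Real.pi| * (4 / (1 - a) ^ 2) *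
      (a ^ (s + 1) * (2 / d ^ 2)) * Real.Gamma (s + 1)
      = a ^ (s - 1) * ((1 + a) ^ 2 / (2 * |Real.Gamma (-s)|)) := by
    -- Reflection at -s turns |sin πs| Γ(s+1)/π into 1/|Γ(-s)|.
    have hrefl := Real.Gamma_mul_Gamma_one_sub (-s)
    rw [sub_neg_eq_add, add_comm 1 s, mul_neg, Real.sin_neg] at hrefl
    have hGp : 0 < Real.Gamma (s + 1) := Real.Gamma_pos_of_pos (by linarith)
    have hsin : Real.sin (Real.pi * s) ≠ 0 := by
      intro h0
      obtain ⟨n, hn⟩ := Real.sin_eq_zero_iff.1 h0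
      have hns : s = n := by
        have := Real.pi_pos
        apply mul_left_cancel₀ this.ne'
        rw [← hn]; ring
      have hn0 : 0 ≤ n := by
        have : (0 : ℝ) ≤ n := hns ▸ hs.le
        exact_mod_cast this
      apply hsn n.toNat
      rw [hns]
      exact_mod_cast (Int.toNat_of_nonneg hn0).symm
    have hne : Real.Gamma (-s) ≠ 0 := by
      intro h0
      rw [h0, zero_mul, eq_comm, div_eq_zero_iff] at hrefl
      rcases hrefl with h | h
      · exact Real.pi_ne_zero h
      · exact hsin (neg_eq_zero.1 h)
    have habs : |Real.sin (Real.pi * s) / Real.pi| * Real.Gamma (s + 1) = |Real.Gamma (-s)|⁻¹ := by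
      have h3 := congrArg abs hrefl
      rw [abs_mul, abs_of_pos hGp, abs_div, abs_neg] at h3
      have h4 : 0 < |Real.Gamma (-s)| := abs_pos.2 hne
      have h5 : 0 < |Real.sin (Real.pi * s)| := abs_pos.2 hsin
      have h6 : 0 < |Real.pi| := abs_pos.2 Real.pi_ne_zero
      rw [abs_div, eq_comm, inv_eq_iff_eq_inv, mul_inv, inv_div, eq_div_iff hGp.ne' |>.2 h3]
      rw [div_eq_mul_inv (_ / _)]
    have hdv : d = 4 * a / ((1 - a) * (1 + a)) := by
      rw [hd, hρ]; field_simp; ring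
    have hpow : a ^ (s + 1) = a ^ (s - 1) * a ^ 2 := by
      rw [← Real.rpow_natCast a 2, ← Real.rpow_add ha0]; congr 1; push_cast; ring
    calc _ = (|Real.sin (Real.pi * s) / Real.pi| * Real.Gamma (s + 1)) * ((4 / (1 - a) ^ 2) *
          (a ^ (s + 1) * (2 / d ^ 2))) := by ring
      _ = _ := by
        rw [habs, hdv, hpow]
        have h4 : 0 < |Real.Gamma (-s)| := abs_pos.2 hne
        field_simp
        norm_num
  rw [hconst] at hlim
  refine hlim.congr' ?_
  filter_upwards [eventually_gt_atTop 0] with m hm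
  have hm0 : (0 : ℝ) < m := by exact_mod_cast hm
  have hS0 := eval_zero_extremalPoly_pos ha0 ha1 m
  rw [integral_rpow_mul_eq_rescale s (fun u =>
    ((extremalPoly a m).eval (-u))⁻¹ * w m u) (show 0 < a / m by positivity)]
  have e3 : ∀ v, v ^ s * ((extremalPoly a m).eval 0 * ((extremalPoly a m).eval (-(a / m * v)))⁻¹
      * w m (a / m * v)) = (extremalPoly a m).eval 0 * (v ^ s *
        (((extremalPoly a m).eval (-(a / m * v)))⁻¹ * w m (a / m * v))) := fun v => by ring
  simp only [e3]
  rw [integral_const_mul, eval_zero_extremalPoly ha0 ha1, ← hρ, ← hd, Real.div_rpow ha0.le hm0.le]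
  have := Real.rpow_pos_of_pos hm0 (s + 1)
  field_simp

end

/-! ### Bounds for the error of best approximation -/

section
open MeasureTheory Set

theorem integrableOn_rpow_mul_extremalPoly_inv_mul {a s : ℝ} (ha0 : 0 < a) (ha1 : a < 1)
    (hs : 0 ≤ s) {m : ℕ} (hm : s < m) {w : ℝ → ℝ} (hwm : Measurable w) {M : ℝ}
    (hw : ∀ u > 0, |w u| ≤ M) :
    IntegrableOn (fun u : ℝ => u ^ s * (((extremalPoly a m).eval (-u))⁻¹ * w u)) (Ioi 0) := by
  have hmeas : Measurable fun u : ℝ => (extremalPoly a m).eval (-u) :=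
    (by fun_prop : Continuous _).measurable
  refine Integrable.mono' ((integrableOn_rpow_div_extremalPoly ha0 ha1 hs hm).mul_const M)
    (Measurable.aestronglyMeasurable (by fun_prop)) ?_
  refine (ae_restrict_mem measurableSet_Ioi).mono fun u hu => ?_
  have hu' : 0 < u := hu
  have h2 := eval_neg_extremalPoly_pos ha0 ha1 m hu'.le
  have h3 := Real.rpow_nonneg hu'.le s
  rw [← mul_assoc, ← div_eq_mul_inv, norm_mul, Real.norm_of_nonneg (by positivity)]
  gcongr
  exact hw u hu'

theorem integral_rpow_mul_extremalPoly_inv_mono {a s : ℝ} (ha0 : 0 < a) (ha1 : a < 1)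
    (hs : 0 ≤ s) {m : ℕ} (hm : s < m) {w₁ w₂ : ℝ → ℝ} (hm₁ : Measurable w₁) (hm₂ : Measurable w₂)
    (h1 : ∀ u > 0, 0 ≤ w₁ u) (h12 : ∀ u > 0, w₁ u ≤ w₂ u) (h2 : ∀ u > 0, w₂ u ≤ 1) :
    ∫ u in Ioi (0 : ℝ), u ^ s * (((extremalPoly a m).eval (-u))⁻¹ * w₁ u)
      ≤ ∫ u in Ioi (0 : ℝ), u ^ s * (((extremalPoly a m).eval (-u))⁻¹ * w₂ u) := by
  refine setIntegral_mono_on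
    (integrableOn_rpow_mul_extremalPoly_inv_mul ha0 ha1 hs hm hm₁ (M := 1) fun u hu => ?_)
    (integrableOn_rpow_mul_extremalPoly_inv_mul ha0 ha1 hs hm hm₂ (M := 1) fun u hu => ?_)
    measurableSet_Ioi fun u hu => ?_
  · rw [abs_of_nonneg (h1 u hu)]; exact (h12 u hu).trans (h2 u hu)
  · rw [abs_of_nonneg ((h1 u hu).trans (h12 u hu))]; exact h2 u hu
  · have hu' : 0 < u := hu
    have h3 := eval_neg_extremalPoly_pos ha0 ha1 m hu'.le
    have h4 := Real.rpow_nonneg hu'.le s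
    have := h12 u hu'
    gcongr

theorem mul_integral_rpow_mul_extremalPoly_inv (a s t : ℝ) (m : ℕ) :
    t * ∫ u in Ioi (0 : ℝ), u ^ s * (((extremalPoly a m).eval (-u))⁻¹ * (t + u)⁻¹)
      = ∫ u in Ioi (0 : ℝ), u ^ s * (((extremalPoly a m).eval (-u))⁻¹ * (t / (t + u))) := by
  rw [← integral_const_mul]
  congr 1
  ext u
  rw [div_eq_mul_inv]
  ring

/-- The factor t in the bound for |S(t)| joins 1/(t+u) to form the weight t/(t+u) ≤ 1. -/
theorem abs_rpow_sub_interpolation_le {a s t K : ℝ} (ha0 : 0 < a) (ha1 : a < 1) (hs : 0 ≤ s)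
    {m : ℕ} (hm : s < m) (ht : t ∈ Icc (a ^ 2) 1) :
    |K * ((extremalPoly a m).eval t *
        ∫ u in Ioi (0 : ℝ), u ^ s * (((extremalPoly a m).eval (-u))⁻¹ * (t + u)⁻¹))|
      ≤ |K| * (4 / (1 - a) ^ 2) *
        ∫ u in Ioi (0 : ℝ), u ^ s * (((extremalPoly a m).eval (-u))⁻¹ * 1) := by
  have ht0 : 0 < t := lt_of_lt_of_le (by positivity) ht.1
  have h1 : 0 < 1 - a := by linarith
  have hnn : 0 ≤ ∫ u in Ioi (0 : ℝ), u ^ s * (((extremalPoly a m).eval (-u))⁻¹ * (t + u)⁻¹) := by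
    refine setIntegral_nonneg measurableSet_Ioi fun u hu => ?_
    have hu' : 0 < u := hu
    have h3 := eval_neg_extremalPoly_pos ha0 ha1 m hu'.le
    have h4 := Real.rpow_nonneg hu'.le s
    positivity
  rw [abs_mul, abs_mul, abs_of_nonneg hnn, mul_assoc |K|]
  refine mul_le_mul_of_nonneg_left ?_ (abs_nonneg K)
  refine (mul_le_mul_of_nonneg_right (abs_eval_extremalPoly_le ha0 ha1 m ht.1 ht.2) hnn).trans ?_
  rw [mul_assoc, mul_integral_rpow_mul_extremalPoly_inv]
  refine mul_le_mul_of_nonneg_left ?_ (by positivity)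
  refine integral_rpow_mul_extremalPoly_inv_mono ha0 ha1 hs hm (w₁ := fun u => t / (t + u))
    (w₂ := fun _ => 1) (by fun_prop) (by fun_prop)
    (fun u hu => by positivity) (fun u hu => ?_) (fun u hu => le_rfl)
  rw [div_le_one (by positivity)]
  linarith

/-- At the alternation points the error of Q has alternating signs and the weight t/(t+u), which
increases in t and so is smallest at t = a². -/
theorem exists_le_abs_rpow_sub {a s K : ℝ} (ha0 : 0 < a) (ha1 : a < 1) (hs : 0 ≤ s) {m : ℕ}
    (hm : s < m) {Q q : ℝ[X]} (hQd : Q.natDegree ≤ m) (hq : q.natDegree ≤ m)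
    (hQ : ∀ t > 0, Q.eval t = t ^ s + K * ((extremalPoly a m).eval t *
        ∫ u in Ioi (0 : ℝ), u ^ s * (((extremalPoly a m).eval (-u))⁻¹ * (t + u)⁻¹))) :
    ∃ t ∈ Icc (a ^ 2) 1, |K| * (4 / (1 - a) ^ 2) *
        (∫ u in Ioi (0 : ℝ), u ^ s * (((extremalPoly a m).eval (-u))⁻¹ * (a ^ 2 / (a ^ 2 + u))))
      ≤ |t ^ s - q.eval t| := by
  obtain ⟨x, hxm, hx⟩ := exists_alternation_extremalPoly ha0 ha1 m
  have h1 : 0 < 1 - a := by linarith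
  have halt : ∀ j ≤ m + 1, |K| * (4 / (1 - a) ^ 2) * (∫ u in Ioi (0 : ℝ),
        u ^ s * (((extremalPoly a m).eval (-u))⁻¹ * (a ^ 2 / (a ^ 2 + u))))
      ≤ (-1) ^ j * (-(SignType.sign K : ℝ) * (x j ^ s - Q.eval (x j))) := by
    intro j hj
    obtain ⟨hxj, hev⟩ := hx j hj
    have hx0 : 0 < x j := lt_of_lt_of_le (by positivity) hxj.1
    have hone : ((-1 : ℝ) ^ j) * (-1) ^ j = 1 := by rw [← mul_pow]; simp
    have he : (-1) ^ j * (-(SignType.sign K : ℝ) * (x j ^ s - Q.eval (x j)))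
        = |K| * (4 / (1 - a) ^ 2) * (x j * ∫ u in Ioi (0 : ℝ),
          u ^ s * (((extremalPoly a m).eval (-u))⁻¹ * (x j + u)⁻¹)) := by
      rw [hQ _ hx0, hev, ← sign_mul_self K]
      linear_combination (SignType.sign K * K * (4 / (1 - a) ^ 2) * (x j * ∫ u in Ioi (0 : ℝ),
          u ^ s * (((extremalPoly a m).eval (-u))⁻¹ * (x j + u)⁻¹))) * hone
    rw [he, mul_integral_rpow_mul_extremalPoly_inv]
    refine mul_le_mul_of_nonneg_left ?_ (by positivity)
    refine integral_rpow_mul_extremalPoly_inv_mono ha0 ha1 hs hm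
      (w₁ := fun u => a ^ 2 / (a ^ 2 + u)) (w₂ := fun u => x j / (x j + u))
      (by fun_prop) (by fun_prop)
      (fun u hu => by positivity) (fun u hu => ?_) (fun u hu => ?_)
    · rw [div_le_div_iff₀ (by positivity) (by positivity)]
      nlinarith [hxj.1]
    · rw [div_le_one (by positivity)]
      linarith
  -- Requiring only |ε| ≤ 1 lets the sign of K be 0 without a separate case.
  obtain ⟨j, hj, hle⟩ := exists_le_abs_sub_of_alternating hQd hq x hxm (fun t => t ^ s)
    (ε := -SignType.sign K) (by rcases lt_trichotomy K 0 with h | h | h <;> simp [h]) halt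
  exact ⟨x j, (hx j hj).1, hle⟩

/-! ### Passage to t = x², locally uniform convergence, and comparison near the origin -/

theorem abs_rpow_eq_sq_rpow (p x : ℝ) : |x| ^ p = (x ^ 2) ^ (p / 2) := by
  rw [← sq_abs, ← Real.rpow_natCast, ← Real.rpow_mul (abs_nonneg x)]
  congr 1
  push_cast
  ring

theorem abs_rpow_sub_eval_le_uniformDist_expand {p a : ℝ} (hp : 0 ≤ p) (q : ℝ[X])
    {t : ℝ} (ht : t ∈ Icc (a ^ 2) 1) :
    |t ^ (p / 2) - q.eval t| ≤ uniformDist p a (expand ℝ 2 q) := by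
  have ht0 : 0 ≤ t := (sq_nonneg a).trans ht.1
  have h := abs_sub_eval_le_uniformDist (a := a) hp (expand ℝ 2 q) (x := √t)
    (Or.inr ⟨Real.le_sqrt_of_sq_le ht.1, Real.sqrt_le_one.2 ht.2⟩)
  rwa [abs_rpow_eq_sq_rpow, expand_eval, Real.sq_sqrt ht0] at h

theorem uniformDist_expand_le {p a M : ℝ} (ha0 : 0 < a) (ha1 : a ≤ 1) {q : ℝ[X]}
    (h : ∀ t ∈ Icc (a ^ 2) 1, |t ^ (p / 2) - q.eval t| ≤ M) :
    uniformDist p a (expand ℝ 2 q) ≤ M := by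
  refine uniformDist_le ha1 fun x hx => ?_
  rw [abs_rpow_eq_sq_rpow, expand_eval]
  apply h
  rcases hx with hx | hx <;> constructor <;> nlinarith [hx.1, hx.2]

/-- Joint convergence in the index and the point already forces f to be continuous on K: freezing
the point y in the hypothesis gives dist (f y) (f x) ≤ ε/3. -/
theorem tendstoUniformlyOn_of_tendsto_prod {F : ℕ → ℝ → ℝ} {f : ℝ → ℝ} {K : Set ℝ}
    (hK : IsCompact K) (h : ∀ x ∈ K, Tendsto (fun y : ℕ × ℝ => F y.1 y.2) (atTop ×ˢ 𝓝[K] x)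
      (𝓝 (f x))) : TendstoUniformlyOn F f atTop K := by
  rw [← tendstoLocallyUniformlyOn_iff_tendstoUniformlyOn_of_compact hK,
    Metric.tendstoLocallyUniformlyOn_iff]
  intro ε hε x hx
  have h1 := (h x hx).eventually (Metric.ball_mem_nhds (f x) (show 0 < ε / 3 by positivity))
  obtain ⟨pa, hpa, pb, hpb, hab⟩ := eventually_prod_iff.1 h1
  refine ⟨{y | pb y} ∩ K, inter_mem hpb self_mem_nhdsWithin, ?_⟩
  filter_upwards [hpa] with n hn y hy
  have h2 : Tendsto (fun n => F n y) atTop (𝓝 (f y)) := (h y hy.2).comp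
    (tendsto_id.prodMk (tendsto_const_pure.mono_right (pure_le_nhdsWithin hy.2)))
  have h3 : dist (f y) (f x) ≤ ε / 3 :=
    le_of_tendsto (h2.dist tendsto_const_nhds) (hpa.mono fun k hk => (hab hk hy.1).le)
  have h4 : dist (F n y) (f x) < ε / 3 := hab hn hy.1
  have := dist_triangle_right (f y) (F n y) (f x)
  linarith

/-- Polynomials that are small on `[a ^ 2, 1]`, compared to the error of best approximation, are
negligible near the origin. -/
theorem tendsto_rescaled_of_small {a s L : ℝ} (ha0 : 0 < a) (ha1 : a < 1) {U : ℕ → ℝ}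
    (hU0 : ∀ᶠ m in atTop, 0 < U m)
    (hU : Tendsto (fun m : ℕ => ((1 + a) / (1 - a)) ^ (m + 1) * (m : ℝ) ^ (s + 1) * U m) atTop
      (𝓝 L))
    {D : ℕ → ℝ[X]} (hDd : ∀ᶠ m in atTop, (D m).natDegree ≤ m)
    (hD : ∀ᶠ m in atTop, ∀ t ∈ Icc (a ^ 2) 1, |(D m).eval t| ≤ U m)
    {ι : Type*} {l : Filter ι} {N : ι → ℕ} (hN : Tendsto N l atTop) {x : ι → ℝ} {x₀ : ℝ}
    (hx : Tendsto x l (𝓝 x₀)) :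
    Tendsto (fun i => (N i / a) ^ s * (D (N i)).eval (a / N i * x i)) l (𝓝 0) := by
  have h1 : 0 < 1 - a := by linarith
  have hNr : Tendsto (fun i => (N i : ℝ)) l atTop := tendsto_natCast_atTop_atTop.comp hN
  have hinv : Tendsto (fun i => (N i : ℝ)⁻¹) l (𝓝 0) := tendsto_inv_atTop_zero.comp hNr
  have ht : Tendsto (fun i => a / N i * x i) l (𝓝 0) := by
    simpa [div_eq_mul_inv] using (hinv.const_mul a).mul hx
  -- The bound U is of order at most ρ^{-N} N^{-s-1}, the growth of T_N near 0 is of order ρ^N, and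
  -- the rescaling contributes N^s, which leaves a factor 1/N.
  have hE := (Real.continuous_exp.tendsto _).comp (tendsto_mul_greenFun_sub ha0 ha1 hN hx 0)
  have hlim := (((hU.comp hN).mul hE).mul hinv).const_mul (a ^ (-s) * ((1 + a) / (1 - a))⁻¹)
  rw [mul_zero, mul_zero] at hlim
  refine squeeze_zero_norm' ?_ hlim
  filter_upwards [hN.eventually hU0, hN.eventually hDd, hN.eventually hD,
    ht.eventually_lt_const (show (0 : ℝ) < a ^ 2 by positivity), hN.eventually_gt_atTop 0]
    with i hi0 hid hib hit hNi
  have hN0 : (0 : ℝ) < N i := by exact_mod_cast hNi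
  have hgrow := abs_eval_le_mul_chebyshev ha0 ha1 hit hi0 hid hib
  have hu := (one_lt_toUnit ha0 ha1 hit).le
  have hT : (Chebyshev.T ℝ (N i)).eval (toUnit a (a / N i * x i))
      ≤ Real.exp (N i * greenFun a (a / N i * x i)) := by
    have hg0 : 0 ≤ greenFun a (a / N i * x i) := Real.arcosh_nonneg hu
    rw [← Real.cosh_arcosh hu, Chebyshev.T_real_cosh, Real.cosh_eq]
    push_cast
    have : Real.exp (-(N i * Real.arcosh (toUnit a (a / N i * x i))))
        ≤ Real.exp (N i * Real.arcosh (toUnit a (a / N i * x i))) := by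
      apply Real.exp_le_exp.2
      have : 0 ≤ N i * Real.arcosh (toUnit a (a / N i * x i)) := mul_nonneg hN0.le hg0
      linarith
    unfold greenFun
    linarith
  have hpow : ((1 + a) / (1 - a)) ^ (N i + 1)
      = Real.exp (N i * greenFun a 0) * ((1 + a) / (1 - a)) := by
    rw [pow_succ, Real.exp_nat_mul, exp_greenFun_zero ha0 ha1]
  have hpos : 0 < (N i / a : ℝ) ^ s := Real.rpow_pos_of_pos (by positivity) s
  simp only [Function.comp_apply]
  rw [norm_mul, Real.norm_of_nonneg hpos.le, Real.norm_eq_abs]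
  refine (mul_le_mul_of_nonneg_left (hgrow.trans (mul_le_mul_of_nonneg_left hT hi0.le))
    hpos.le).trans (le_of_eq ?_)
  rw [hpow, add_zero, mul_sub, Real.exp_sub, Real.div_rpow hN0.le ha0.le, Real.rpow_neg ha0.le,
    Real.rpow_add_one hN0.ne', show a * x i / N i = a / N i * x i by ring]
  have := Real.rpow_pos_of_pos ha0 s
  field_simp

end

/-! ### The two limits -/

theorem theorem6p1 (p a : ℝ) (hp : 0 < p) (hpe : ∀ k : ℤ, p ≠ 2 * (k : ℝ))
    (ha0 : 0 < a) (ha1 : a < 1) :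
    Tendsto
      (fun m : ℕ => ((1 + a) / (1 - a)) ^ (m + 1) * (m : ℝ) ^ (p / 2 + 1) *
        approxError (2 * m) p a)
      atTop
      (𝓝 (a ^ (p / 2 - 1) * ((1 + a) ^ 2 / (2 * |Real.Gamma (-(p / 2))|)))) ∧
    (∀ m : ℕ, ∃! P : ℝ[X], IsBestApprox (2 * m) p a P) ∧
    ∀ P : ℕ → ℝ[X], (∀ m, IsBestApprox (2 * m) p a (P m)) →
      ∀ K : Set ℝ, K ⊆ Set.Ioi 0 → IsCompact K →
        TendstoUniformlyOn
          (fun (m : ℕ) (l : ℝ) =>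
            ((m : ℝ) / a) ^ (p / 2) * (P m).eval (Real.sqrt (a / (m : ℝ)) * l))
          (limitFun p) atTop K := by
  have hs : 0 < p / 2 := by positivity
  have h1a : 0 < 1 - a := by linarith
  have hsn : ∀ n : ℕ, p / 2 ≠ n := fun n hn => hpe n (by push_cast; linarith)
  have hex : ∀ m : ℕ, ∃! P : ℝ[X], IsBestApprox (2 * m) p a P := fun m =>
    existsUnique_isBestApprox hp.le ha1 (2 * m)
  set κ : ℝ := Real.sin (Real.pi * (p / 2)) / Real.pi with hκ
  -- For m ≤ p/2 the choice is an irrelevant default; only large m enter the limits.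
  have hQex : ∀ m : ℕ, ∃ Q : ℝ[X], p / 2 < m → Q.natDegree ≤ m ∧ ∀ t > 0, Q.eval t =
      t ^ (p / 2) + κ * ((extremalPoly a m).eval t *
        ∫ u in Set.Ioi (0 : ℝ), u ^ (p / 2) * (((extremalPoly a m).eval (-u))⁻¹ * (t + u)⁻¹)) := by
    intro m
    by_cases hm : p / 2 < m
    · obtain ⟨Q, hQ⟩ := exists_interpolation_extremalPoly ha0 ha1 hs hsn hm
      exact ⟨Q, fun _ => hQ⟩
    · exact ⟨0, fun h => absurd h hm⟩
  choose Q hQ using hQex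
  have hlarge : ∀ᶠ m : ℕ in atTop, p / 2 < m :=
    tendsto_natCast_atTop_atTop.eventually_gt_atTop (p / 2)
  set U : ℕ → ℝ := fun m => |κ| * (4 / (1 - a) ^ 2) *
    ∫ u in Set.Ioi (0 : ℝ), u ^ (p / 2) * (((extremalPoly a m).eval (-u))⁻¹ * 1) with hU
  have hQerr : ∀ m : ℕ, p / 2 < m → ∀ t ∈ Set.Icc (a ^ 2) 1,
      |t ^ (p / 2) - (Q m).eval t| ≤ U m := by
    intro m hm t ht
    rw [(hQ m hm).2 t (lt_of_lt_of_le (by positivity) ht.1), sub_add_cancel_left, abs_neg]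
    exact abs_rpow_sub_interpolation_le ha0 ha1 hs.le hm ht
  have hupper : ∀ m : ℕ, p / 2 < m → approxError (2 * m) p a ≤ U m := by
    intro m hm
    obtain ⟨P, hP, -⟩ := hex m
    rw [approxError_eq_of_isBestApprox hP]
    refine (hP.2 (expand ℝ 2 (Q m)) ?_).trans (uniformDist_expand_le ha0 ha1.le (hQerr m hm))
    rw [natDegree_expand]
    have := (hQ m hm).1
    omega
  have hUlim : Tendsto (fun m : ℕ => ((1 + a) / (1 - a)) ^ (m + 1) * (m : ℝ) ^ (p / 2 + 1) * U m)
      atTop (𝓝 (a ^ (p / 2 - 1) * ((1 + a) ^ 2 / (2 * |Real.Gamma (-(p / 2))|)))) :=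
    tendsto_error_constant ha0 ha1 hs hsn (w := fun _ _ => 1) (fun _ => measurable_const)
      (fun _ _ _ => by simp) (fun _ _ => tendsto_const_nhds)
  refine ⟨?_, hex, fun P hP K hK hKc => ?_⟩
  · have hLlim := tendsto_error_constant ha0 ha1 hs hsn (w := fun _ u => a ^ 2 / (a ^ 2 + u))
      (fun _ => by fun_prop) (fun i v hv => by
        have : 0 ≤ a / i * v := by positivity
        rw [abs_of_nonneg (by positivity), div_le_one (by positivity)]
        linarith) (fun v hv => by
        have h1 : Tendsto (fun i : ℕ => a ^ 2 / (a ^ 2 + a / i * v)) atTop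
            (𝓝 (a ^ 2 / (a ^ 2 + 0 * v))) :=
          tendsto_const_nhds.div
            (((tendsto_const_div_atTop_nhds_zero_nat a).mul_const v).const_add _) (by simp; positivity)
        rwa [zero_mul, add_zero, div_self (by positivity)] at h1)
    -- The weights a²/(a²+u) and 1 squeeze the error between bounds with the same limit.
    refine tendsto_of_tendsto_of_tendsto_of_le_of_le' hLlim hUlim ?_ ?_
    · filter_upwards [hlarge] with m hm
      gcongr
      obtain ⟨P, hP, -⟩ := hex m
      obtain ⟨q, hqd, rfl⟩ := hP.exists_expand hp.le ha1
      obtain ⟨t, ht, hle⟩ := exists_le_abs_rpow_sub ha0 ha1 hs.le hm (hQ m hm).1 hqd (hQ m hm).2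
      rw [approxError_eq_of_isBestApprox hP]
      exact hle.trans (abs_rpow_sub_eval_le_uniformDist_expand hp.le q ht)
    · filter_upwards [hlarge] with m hm
      gcongr
      exact hupper m hm
  · have hq : ∀ m, ∃ q : ℝ[X], q.natDegree ≤ m ∧ P m = expand ℝ 2 q := fun m =>
      (hP m).exists_expand hp.le ha1
    choose q hqd hPq using hq
    have hUpos : ∀ᶠ m in atTop, 0 < 2 * U m := by
      have hpos : 0 < a ^ (p / 2 - 1) * ((1 + a) ^ 2 / (2 * |Real.Gamma (-(p / 2))|)) := by
        have hG : Real.Gamma (-(p / 2)) ≠ 0 :=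
          Real.Gamma_ne_zero fun n hn => hsn n (neg_injective hn)
        have := abs_pos.2 hG
        positivity
      filter_upwards [hUlim.eventually_const_lt hpos] with m hm
      have := pos_of_mul_pos_right hm (by positivity)
      linarith
    refine tendstoUniformlyOn_of_tendsto_prod hKc fun x hx => ?_
    have hx0 : 0 < x := hK hx
    have hN : Tendsto (fun y : ℕ × ℝ => y.1) (atTop ×ˢ 𝓝[K] x) atTop := tendsto_fst
    have hX : Tendsto (fun y : ℕ × ℝ => y.2 ^ 2) (atTop ×ˢ 𝓝[K] x) (𝓝 (x ^ 2)) :=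
      (tendsto_snd.mono_right nhdsWithin_le_nhds).pow 2
    have hmain := tendsto_rescaled_interpolation ha0 ha1 hs.le hN hX (by positivity)
      (Q := fun y => Q y.1) (hN.eventually (hlarge.mono fun m hm => (hQ m hm).2))
    -- The factor 2 comes from the triangle inequality: the errors of q and Q are each at most U m
    -- on [a², 1].
    have hsmall := tendsto_rescaled_of_small (s := p / 2) ha0 ha1 hUpos
      ((hUlim.const_mul 2).congr fun m => by ring) (D := fun m => q m - Q m)
      (hlarge.mono fun m hm => (natDegree_sub_le_of_le (hqd m) (hQ m hm).1).trans (max_self m).le)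
      (hlarge.mono fun m hm t ht => by
        have h1 := hQerr m hm t ht
        have h2 := abs_rpow_sub_eval_le_uniformDist_expand hp.le (q m) ht
        rw [← hPq, ← approxError_eq_of_isBestApprox (hP m)] at h2
        have h3 := hupper m hm
        rw [eval_sub, show (q m).eval t - (Q m).eval t = (t ^ (p / 2) - (Q m).eval t)
          - (t ^ (p / 2) - (q m).eval t) by ring]
        exact (abs_sub _ _).trans (by linarith)) hN hX
    rw [limitFun_eq hx0]
    have hsum := hmain.add hsmall
    rw [add_zero] at hsum
    refine hsum.congr fun y => ?_
    rw [hPq, expand_eval, mul_pow, Real.sq_sqrt (by positivity), eval_sub]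
    ring
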